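/- Let $n\ge 3$. An *$n$-crossing projection* is a planar projection of a link all of whose singular points are $n$-crossings, i.e. points at which exactly $n$ strands, lying at distinct heights, cross so that each strand bisects the crossing. A *split* of an $n$-crossing is a system of $n$ pairwise disjoint arcs inside a small disk around the crossing that joins the $2n$ endpoints on the boundary circle in pairs (up to isotopy). A *split move* replaces two arcs of a split by another pair of arcs with the same four endpoints so that the result is again a split. The *skein relation* of an $n$-crossing, a formal sum of *terms* $J A^{t}\,S$ with $S$ a split and $J,t$ integers, is obtained by adding the strands one at a time from the lowest to the highest: each new strand is laid on top of the split of each term found so far (meeting each arc at most once), and the resulting double crossings are resolved in all possible ways as $A$-splits and $B$-splits, each $A$-split multiplying the coefficient by $A$ and each $B$-split by $A^{-1}$; finally equal splits with equal powers of $A$ are collected into one term. For terms $S,T$ of one skein relation write $S\prec T$ if their splits are related by one split move and the power of $A$ in $S$ is that in $T$ minus $2$, and let $<$ be the partial order generated by $\prec$. A *high* (*low*) *split* is a split that appears in a maximal (minimal) term with respect to $<$. A *state* $s$ of a projection is a choice of a term of the skein relation at every crossing; $|s|$ is the number of disjoint closed curves that remain when every crossing is replaced by the split of its chosen term. The state contributes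 to the bracket polynomial the summand $\prod_i J_iA^{t_i}\cdot(-A^2-A^{-2})^{|s|-1}$, where $J_iA^{t_i}$ are the coefficients of the chosen terms. A *maximal state* $s_{\max}$ (*minimal state* $s_{\min}$) is a state whose summand contains the highest (lowest) power of $A$ occurring in the summands of all states, and all of whose splits are high (low) splits. **Theorem.** Let $P$ be a connected $n$-crossing projection with $c_n$ crossings, $n\ge 3$. Then every maximal state $s_{\max}$ and every minimal state $s_{\min}$ of $P$ satisfy $$|s_{\max}|+|s_{\min}|\le (2n-4)\,c_n+2 .$$ -/

import Mathlib

open scoped LaurentPolynomial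

/-- A split of an `n`-crossing. The `2 * n` endpoints on the boundary circle of the crossing are
numbered `0, 1, …, 2 * n - 1` in clockwise order; a split joins them in pairs by `n` pairwise
disjoint arcs inside the circle, and `partner p` is the other end of the arc that starts at `p`.
Two arcs with ends `p < q` on the one and the other side cross exactly if their ends interlace. -/
@[ext]
structure MultiSplit (n : ℕ) where
  partner : Fin (2 * n) → Fin (2 * n)
  involutive : Function.Involutive partner
  ne_self : ∀ p, partner p ≠ p
  noncrossing : ∀ p q, p < q → q < partner p → partner q < partner p

namespace MultiSplit

/-- `T` is obtained from `S` by one split move: two arcs `p – q` and `r – s` of `S` are replaced by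
the arcs `p – r` and `q – s`, and all other arcs are kept. As `T` is again a split, no crossing
arises, and so the two arcs are adjacent and the new pair is the only other crossingless one. -/
def IsMove {n : ℕ} (S T : MultiSplit n) : Prop :=
  ∃ p q r s : Fin (2 * n), S.partner p = q ∧ S.partner r = s ∧ r ≠ p ∧ r ≠ q ∧
    T.partner p = r ∧ T.partner q = s ∧
    ∀ u, u ≠ p → u ≠ q → u ≠ r → u ≠ s → T.partner u = S.partner u

end MultiSplit

namespace MultiSkein

variable {n : ℕ}

/-- The two ends of the strand `i` of an `n`-crossing are the opposite endpoints `i` and `i + n`. -/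
def strandStart (i : Fin n) : Fin (2 * n) := ⟨i, by omega⟩

/-- See `strandStart`. -/
def strandEnd (i : Fin n) : Fin (2 * n) := ⟨i + n, by omega⟩

/-- Add an arc between `x` and `y` to a system of arcs. -/
def join (f : Fin (2 * n) → Fin (2 * n)) (x y : Fin (2 * n)) : Fin (2 * n) → Fin (2 * n) :=
  Function.update (Function.update f x y) y x

/-- The endpoints `p` on the clockwise side from the start to the end of strand `i` whose arcs in
`f` are crossed by a strand laid along `i`, in the order in which that strand meets these arcs. -/
def crossed (f : Fin (2 * n) → Fin (2 * n)) (i : Fin n) : List (Fin (2 * n)) :=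
  (List.finRange (2 * n)).filter fun p =>
    (strandStart i < p ∧ p < strandEnd i) ∧ ¬ (strandStart i < f p ∧ f p < strandEnd i)

/-- Resolve, one after the other, the double crossings of an overstrand with the arcs listed.
The piece of the overstrand before the next crossing comes from the endpoint `c`, the overstrand
ends at `b`, and the arc that it meets next runs from `p`, on its left, to `f p`, on its right.
An `A`-split joins `c` to `p` (the incoming overstrand turns counterclockwise, to its left), lets
the arc from `f p` run on along the overstrand, and multiplies by `A`; a `B`-split does the same
with the two sides exchanged and multiplies by `A⁻¹`.
The result lists each outcome together with its power of `A`, starting from the power `t`. -/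
def resolve (b : Fin (2 * n)) :
    List (Fin (2 * n)) → Fin (2 * n) → (Fin (2 * n) → Fin (2 * n)) × ℤ →
      List ((Fin (2 * n) → Fin (2 * n)) × ℤ)
  | [], c, (f, t) => [(join f c b, t)]
  | p :: ps, c, (f, t) =>
      resolve b ps (f p) (join f c p, t + 1) ++ resolve b ps p (join f c (f p), t - 1)

/-- Lay the strand `i` on top of a system of arcs and resolve all resulting double crossings in
all possible ways. -/
def addOverstrand (i : Fin n) (T : (Fin (2 * n) → Fin (2 * n)) × ℤ) :
    List ((Fin (2 * n) → Fin (2 * n)) × ℤ) :=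
  resolve (strandEnd i) (crossed T.1 i) (strandStart i) T

/-- All resolutions of an `n`-crossing, with their powers of `A`, where `σ 0, σ 1, …` are the
strands from the bottom to the top. The strands are added one at a time, each over all previous
ones. An endpoint `p` of a strand that is not yet present has `f p = p`; at the beginning no strand
is present. An outcome that arises several times is listed several times. -/
def resolutions (σ : Equiv.Perm (Fin n)) : List ((Fin (2 * n) → Fin (2 * n)) × ℤ) :=
  (List.finRange n).foldl (fun L k => L.flatMap (addOverstrand (σ k))) [(id, 0)]

/-- A term `J A ^ t · S` of the skein relation of an `n`-crossing with strand order `σ`. -/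
@[ext]
structure Term (σ : Equiv.Perm (Fin n)) where
  split : MultiSplit n
  power : ℤ
  mem : (split.partner, power) ∈ resolutions σ

namespace Term

variable {σ : Equiv.Perm (Fin n)}

/-- The integer `J` in the coefficient `J A ^ t` of a term. -/
def mult (S : Term σ) : ℕ := (resolutions σ).count (S.split.partner, S.power)

/-- The covering relation `S ≺ T`. -/
def Covers (S T : Term σ) : Prop := S.split.IsMove T.split ∧ S.power = T.power - 2

/-- The partial order `S < T` generated by the covering relation. -/
def Below (S T : Term σ) : Prop := Relation.TransGen Covers S T

end Term

/-- A high split is a split that appears in a maximal term. -/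
def IsHighSplit (σ : Equiv.Perm (Fin n)) (S : MultiSplit n) : Prop :=
  ∃ T : Term σ, T.split = S ∧ ∀ T' : Term σ, ¬ T.Below T'

/-- A low split is a split that appears in a minimal term. -/
def IsLowSplit (σ : Equiv.Perm (Fin n)) (S : MultiSplit n) : Prop :=
  ∃ T : Term σ, T.split = S ∧ ∀ T' : Term σ, ¬ T'.Below T

end MultiSkein

/-- The faces of a graph that is drawn on closed surfaces (one for each component of the graph),
with `c` vertices of degree `m`, where `edge` exchanges the two ends of each edge and where the
edge ends at a vertex `x` are `(x, 0), (x, 1), …` in their cyclic order: the faces are the cycles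
of the permutation that runs along an edge and then turns to the next edge end. -/
noncomputable def faceCount {c m : ℕ} (edge : Equiv.Perm (Fin c × Fin m)) : ℕ :=
  Nat.card (Quotient (Equiv.Perm.SameCycle.setoid
    (edge.trans (Equiv.prodCongr (Equiv.refl (Fin c)) (finRotate m)))))

/-- The number of connected components of the graph described by `edge`. -/
noncomputable def graphComponents {c m : ℕ} (edge : Equiv.Perm (Fin c × Fin m)) : ℕ :=
  Nat.card (Quot fun x y : Fin c => ∃ e e' : Fin m, edge (x, e) = (y, e'))

/-- A projection of a link with `c` crossings, all of them `n`-crossings, given combinatorially.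
At each crossing `x`, the points `(x, 0), …, (x, 2 * n - 1)` are the endpoints around it in
clockwise order, so that its strands join `(x, i)` to `(x, i + n)`. (How the connected components
of a disconnected projection are placed in each other's regions is not recorded.) -/
structure MultiProjection (n c : ℕ) where
  /-- The strands of each crossing, from the bottom to the top. -/
  order : Fin c → Equiv.Perm (Fin n)
  /-- Leaving a crossing through an endpoint one arrives at the next endpoint `edge` of it. -/
  edge : Equiv.Perm (Fin c × Fin (2 * n))
  edge_involutive : Function.Involutive edge
  edge_ne_self : ∀ p, edge p ≠ p
  /-- The number of components of the projection without crossings. -/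
  circles : ℕ
  /-- The projection lies in the plane, by Euler's formula: there are `c` vertices and `n * c`
  edges. -/
  planar : c + faceCount edge = n * c + 2 * graphComponents edge

namespace MultiProjection

variable {n c : ℕ}

/-- The projection, as a subset of the plane, has exactly one connected component. -/
def IsConnected (P : MultiProjection n c) : Prop := graphComponents P.edge + P.circles = 1

/-- A state resolves each crossing by a term of its skein relation. -/
abbrev State (P : MultiProjection n c) : Type := ∀ x : Fin c, MultiSkein.Term (P.order x)

/-- The number `|s|` of connected components (topological circles) of a state. -/
noncomputable def State.components {P : MultiProjection n c} (s : P.State) : ℕ :=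
  Nat.card (Quot fun p q : Fin c × Fin (2 * n) =>
    q = P.edge p ∨ q = (p.1, (s p.1).split.partner p.2)) + P.circles

/-- The summand that a state contributes to the bracket polynomial: the product of the
coefficients `J A ^ t` of its terms and of `(-A ^ 2 - A ^ (-2)) ^ (|s| - 1)`. -/
noncomputable def State.summand {P : MultiProjection n c} (s : P.State) : ℤ[T;T⁻¹] :=
  (∏ x, LaurentPolynomial.C ((s x).mult : ℤ) * LaurentPolynomial.T (s x).power) *
    (-LaurentPolynomial.T 2 - LaurentPolynomial.T (-2)) ^ (s.components - 1)

/-- The powers of `A` that occur in the summands of the state sum. -/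
def powers (P : MultiProjection n c) : Set ℤ := {k | ∃ s : P.State, k ∈ s.summand.coeff.support}

/-- A maximal state: its summand contains the highest power of `A`, all its splits are high. -/
def State.IsMaximal {P : MultiProjection n c} (s : P.State) : Prop :=
  (∃ M ∈ s.summand.coeff.support, IsGreatest P.powers M) ∧
    ∀ x, MultiSkein.IsHighSplit (P.order x) (s x).split

/-- A minimal state: its summand contains the lowest power of `A`, all its splits are low. -/
def State.IsMinimal {P : MultiProjection n c} (s : P.State) : Prop :=
  (∃ m ∈ s.summand.coeff.support, IsLeast P.powers m) ∧
    ∀ x, MultiSkein.IsLowSplit (P.order x) (s x).split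

end MultiProjection

/-! Let `e` be the edge involution on the `2nc` endpoints, and let `a` and `b` be the involutions
given by the splits of the maximal and of the minimal state. They form a cubic graph with three edge
colours, whose `ea`- and `eb`-cycles are the closed curves of the two states. Let `m` be the number
of `ab`-cycles and `k` the number of components of this graph. Gluing a disk to each two-coloured
cycle gives a closed surface of Euler characteristic `|smax| + |smin| + m - nc`, which is at most
`2k` (`genus_inequality`, proved by linear algebra over the field with two elements). Connectedness
of the projection gives `k + c ≤ m + 1` (`finrank_inf_add_le_of_connected`). Hence `|smax| + |smin|
≤ (n - 2)c + m + 2`, and it remains to see that `m ≤ (n - 2)c`.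

This is a local question: the union of two splits of an `n`-crossing has `n` closed curves if they
are equal, `n - 1` if they differ by one move, and at most `n - 2` otherwise
(`two_mul_card_components_add_three_le`). So a high and a low split must be neither equal nor
related by a move.

That is `MultiSkein.IsExtreme.ne_and_not_arcMove`, an induction that removes the top strand.
Flipping one double crossing is a move that changes the power of `A` by 2, and so an extreme
resolution resolves all crossings of the top strand in the same way. If there are crossings, an
all-`A` strand leaves its start to the left and an all-`B` strand to the right. Comparing this with
the shape of a move leaves only the cases where the top strand meets at most one arc. There every
move below the strand lifts to a move above (`MultiSkein.moveLifts`), the resolutions below are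
extreme as well, and induction applies. -/

/-! ### Invariant functions modulo 2 and the genus inequality. -/

section InvariantFunctions

open Module

/-- The `ZMod 2`-valued functions that are invariant under `a`. -/
def invariantFunctions {X : Type*} (a : X → X) : Submodule (ZMod 2) (X → ZMod 2) where
  carrier := {h | ∀ x, h (a x) = h x}
  add_mem' := fun hu hv x => by simp [hu x, hv x]
  zero_mem' := fun _ => rfl
  smul_mem' := fun c h hh x => by simp [hh x]

/-- Functions on the set of components of two involutions. -/
def quotFunEquiv {X : Type*} (a b : X → X) :
    (Quot (fun p q : X => q = a p ∨ q = b p) → ZMod 2) ≃ₗ[ZMod 2]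
      (invariantFunctions a ⊓ invariantFunctions b : Submodule (ZMod 2) (X → ZMod 2)) where
  toFun g := ⟨fun x => g (Quot.mk _ x),
    fun _ => congrArg g (Eq.symm <| Quot.sound <| Or.inl rfl),
    fun _ => congrArg g (Eq.symm <| Quot.sound <| Or.inr rfl)⟩
  map_add' _ _ := rfl
  map_smul' _ _ := rfl
  invFun h := Quot.lift h.1 (by
    rintro p q (rfl | rfl)
    · exact (h.2.1 p).symm
    · exact (h.2.2 p).symm)
  left_inv g := by
    funext y
    induction y using Quot.ind
    rfl
  right_inv h := rfl

/-- Turns counts of closed curves into dimensions. -/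
theorem finrank_invariantFunctions_inf {X : Type*} [Finite X] (a b : X → X) :
    finrank (ZMod 2)
      (invariantFunctions a ⊓ invariantFunctions b : Submodule (ZMod 2) (X → ZMod 2)) =
      Nat.card (Quot (fun p q : X => q = a p ∨ q = b p)) := by
  have := Fintype.ofFinite (Quot (fun p q : X => q = a p ∨ q = b p))
  rw [← (quotFunEquiv a b).finrank_eq, finrank_fintype_fun_eq_card, Nat.card_eq_fintype_card]

variable {X : Type*} [Fintype X]

theorem sum_eq_zero_of_invariant {a : X → X} (ha : Function.Involutive a) (hne : ∀ x, a x ≠ x)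
    {h : X → ZMod 2} (hh : ∀ x, h (a x) = h x) : ∑ x, h x = 0 :=
  Finset.sum_involution (fun x _ => a x) (fun x _ => by rw [hh, CharTwo.add_self_eq_zero])
    (fun x _ _ => hne x) (fun _ _ => Finset.mem_univ _) (fun x _ => ha x)

theorem dotProduct_eq_zero_of_invariant {a : X → X} (ha : Function.Involutive a)
    (hne : ∀ x, a x ≠ x) {g h : X → ZMod 2} (hg : g ∈ invariantFunctions a)
    (hh : h ∈ invariantFunctions a) : g ⬝ᵥ h = 0 :=
  sum_eq_zero_of_invariant ha hne fun x => by rw [hg x, hh x]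

/-- The dot product embeds `U` into the annihilator of `W`, which has dimension `card X - finrank
W`. -/
theorem finrank_add_finrank_le_of_dotProduct_eq_zero {K : Type*} [Field K]
    (U W : Submodule K (X → K)) (h : ∀ u ∈ U, ∀ w ∈ W, u ⬝ᵥ w = 0) :
    finrank K U + finrank K W ≤ Fintype.card X := by
  classical
  have h1 := Subspace.finrank_add_finrank_dualAnnihilator_eq W
  rw [finrank_fintype_fun_eq_card] at h1
  have h2 : finrank K U ≤ finrank K W.dualAnnihilator := by
    rw [← (dotProductEquiv K X).finrank_map_eq U]
    refine Submodule.finrank_mono ?_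
    rintro _ ⟨u, hu, rfl⟩
    exact (Submodule.mem_dualAnnihilator _).2 fun w hw => h u hu w hw
  omega

/-- The map `g ↦ g ∘ a + g` has its range and, in characteristic 2, also its kernel inside the
invariant functions; rank–nullity gives the factor 2. -/
theorem card_le_two_mul_finrank_invariantFunctions {a : X → X} (ha : Function.Involutive a) :
    Fintype.card X ≤ 2 * finrank (ZMod 2) (invariantFunctions a) := by
  let φ : (X → ZMod 2) →ₗ[ZMod 2] (X → ZMod 2) := LinearMap.funLeft _ _ a + LinearMap.id
  have h1 := φ.finrank_range_add_finrank_ker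
  rw [finrank_fintype_fun_eq_card] at h1
  have h2 : LinearMap.range φ ≤ invariantFunctions a := by
    rintro _ ⟨g, rfl⟩ x
    simp [φ, LinearMap.funLeft_apply, ha x, add_comm]
  have h3 : LinearMap.ker φ ≤ invariantFunctions a := by
    intro g hg x
    have := congrFun (LinearMap.mem_ker.1 hg) x
    exact CharTwo.add_eq_zero.1 this
  have := Submodule.finrank_mono h2
  have := Submodule.finrank_mono h3
  omega

/-- The genus inequality for a cubic graph whose edges are properly coloured with three colours:
if a surface is built by gluing a disk to each two-coloured cycle, then the Euler characteristic
of the surface is at most twice the number of its components. -/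
theorem genus_inequality {e a b : X → X} (he : Function.Involutive e)
    (ha : Function.Involutive a) (hb : Function.Involutive b) (hne : ∀ x, e x ≠ x)
    (hna : ∀ x, a x ≠ x) (hnb : ∀ x, b x ≠ x) :
    2 * (finrank (ZMod 2) ↥(invariantFunctions e ⊓ invariantFunctions a) +
      finrank (ZMod 2) ↥(invariantFunctions e ⊓ invariantFunctions b) +
      finrank (ZMod 2) ↥(invariantFunctions a ⊓ invariantFunctions b)) ≤
    Fintype.card X + 4 * finrank (ZMod 2)
      ↥(invariantFunctions e ⊓ (invariantFunctions a ⊓ invariantFunctions b)) := by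
  set E := invariantFunctions e
  set A := invariantFunctions a
  set B := invariantFunctions b
  have h1 := Submodule.finrank_sup_add_finrank_inf_eq (E ⊓ A) (E ⊓ B)
  have h2 := Submodule.finrank_sup_add_finrank_inf_eq E (A ⊓ B)
  rw [← inf_inf_distrib_left] at h1
  have h3 : Fintype.card X ≤ 2 * finrank (ZMod 2) E :=
    card_le_two_mul_finrank_invariantFunctions he
  -- Each of the four products of summands pairs two functions with a common invariance, under `e`,
  -- `e`, `a` and `b` respectively, and therefore vanishes. The rest is the dimension formula, used
  -- in `h1` and `h2`.
  have h4 := finrank_add_finrank_le_of_dotProduct_eq_zero (E ⊓ A ⊔ E ⊓ B) (E ⊔ A ⊓ B) (by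
    intro u hu w hw
    obtain ⟨u1, hu1, u2, hu2, rfl⟩ := Submodule.mem_sup.1 hu
    obtain ⟨w1, hw1, w2, hw2, rfl⟩ := Submodule.mem_sup.1 hw
    rw [add_dotProduct, dotProduct_add, dotProduct_add,
      dotProduct_eq_zero_of_invariant he hne hu1.1 hw1,
      dotProduct_eq_zero_of_invariant he hne hu2.1 hw1,
      dotProduct_eq_zero_of_invariant ha hna hu1.2 hw2.1,
      dotProduct_eq_zero_of_invariant hb hnb hu2.2 hw2.2]
    simp)
  omega

/-- The functions that are constant at each crossing form a `c`-dimensional subspace of the `a`- and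
`b`-invariant ones. Those that are also `e`-invariant agree across every edge, and so are constant
by connectedness: the two subspaces `K` and `range φ` meet in dimension at most 1. -/
theorem finrank_inf_add_le_of_connected {c m : ℕ} (hm : 0 < m) {e a b : Fin c × Fin m → Fin c × Fin m}
    (ha : ∀ p, (a p).1 = p.1) (hb : ∀ p, (b p).1 = p.1)
    (hconn : Nat.card (Quot fun x y : Fin c => ∃ i j : Fin m, e (x, i) = (y, j)) = 1) :
    finrank (ZMod 2)
      ↥(invariantFunctions e ⊓ (invariantFunctions a ⊓ invariantFunctions b)) + c ≤
    finrank (ZMod 2) ↥(invariantFunctions a ⊓ invariantFunctions b) + 1 := by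
  set K := invariantFunctions e ⊓ (invariantFunctions a ⊓ invariantFunctions b)
  set V := invariantFunctions a ⊓ invariantFunctions b
  let φ : (Fin c → ZMod 2) →ₗ[ZMod 2] (Fin c × Fin m → ZMod 2) := LinearMap.funLeft _ _ Prod.fst
  have hφ : Function.Injective φ := LinearMap.funLeft_injective_of_surjective _ _ _
    fun x => ⟨(x, ⟨0, hm⟩), rfl⟩
  have h1 := LinearMap.finrank_range_of_inj hφ
  rw [finrank_fintype_fun_eq_card, Fintype.card_fin] at h1
  have h2 := Submodule.finrank_sup_add_finrank_inf_eq K (LinearMap.range φ)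
  have h3 : K ⊔ LinearMap.range φ ≤ V := by
    refine sup_le inf_le_right ?_
    rintro _ ⟨g, rfl⟩
    exact ⟨fun p => congrArg g (ha p), fun p => congrArg g (hb p)⟩
  have h4 : K ⊓ LinearMap.range φ ≤ Submodule.span (ZMod 2) {fun _ => 1} := by
    rintro _ ⟨hK, g, rfl⟩
    have hsub := (Nat.card_eq_one_iff_unique.1 hconn).1
    have hg : ∀ x y, (∃ i j : Fin m, e (x, i) = (y, j)) → g x = g y := by
      rintro x y ⟨i, j, hij⟩
      have := hK.1 (x, i)
      rw [hij] at this
      exact this.symm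
    obtain ⟨y0⟩ := (Nat.card_eq_one_iff_unique.1 hconn).2
    refine Submodule.mem_span_singleton.2 ⟨Quot.lift g hg y0, ?_⟩
    funext p
    have := congrArg (Quot.lift g hg) (Subsingleton.elim y0 (Quot.mk _ p.1))
    simpa [φ, LinearMap.funLeft_apply] using this
  have h5 : finrank (ZMod 2) (Submodule.span (ZMod 2) {fun _ : Fin c × Fin m => (1 : ZMod 2)}) ≤ 1 :=
    (finrank_span_le_card _).trans (by simp)
  have := Submodule.finrank_mono h3
  have := Submodule.finrank_mono h4
  omega

end InvariantFunctions

/-! ### Closed curves in the union of two splits. -/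

section ArcMove

/-- Two involutions differ by replacing two transpositions `p – q`, `r – s` by `p – r`, `q – s`. -/
def ArcMove {Y : Type*} (S T : Y → Y) : Prop :=
  ∃ p q r s : Y, S p = q ∧ S r = s ∧ r ≠ p ∧ r ≠ q ∧ T p = r ∧ T q = s ∧
    ∀ u, u ≠ p → u ≠ q → u ≠ r → u ≠ s → T u = S u

/-- Every component has at least the two points `x`, `S x`. If `S` and `T` differ by more than a
move, then the components have at least three points in excess of this. -/
theorem two_mul_card_components_add_three_le {Y : Type*} [Fintype Y] {S T : Y → Y}
    (hS : Function.Involutive S) (hT : Function.Involutive T) (hSne : ∀ x, S x ≠ x)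
    (hTne : ∀ x, T x ≠ x) (hST : S ≠ T) (hmove : ¬ ArcMove S T) :
    2 * Nat.card (Quot fun p q : Y => q = S p ∨ q = T p) + 3 ≤ Fintype.card Y := by
  classical
  let π : Y → Quot (fun p q : Y => q = S p ∨ q = T p) := Quot.mk _
  have hπS : ∀ x, π (S x) = π x := fun x => Eq.symm <| Quot.sound <| Or.inl rfl
  have hπT : ∀ x, π (T x) = π x := fun x => Eq.symm <| Quot.sound <| Or.inr rfl
  have := Fintype.ofSurjective π Quot.mk_surjective
  let fib : Quot (fun p q : Y => q = S p ∨ q = T p) → Finset Y := fun y => {x | π x = y}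
  have hcard : Fintype.card Y = ∑ y, (fib y).card := by
    rw [← Finset.card_univ]
    exact Finset.card_eq_sum_card_fiberwise fun _ _ => Finset.mem_univ _
  have h2 : ∀ y, 2 ≤ (fib y).card := by
    intro y
    obtain ⟨x, rfl⟩ := Quot.mk_surjective y
    refine le_trans (b := ({x, S x} : Finset Y).card) ?_ (Finset.card_le_card ?_)
    · rw [Finset.card_pair (hSne x).symm]
    · intro z hz
      simp only [Finset.mem_insert, Finset.mem_singleton] at hz
      rcases hz with rfl | rfl
      · simp [fib, π]
      · simpa [fib] using hπS x
  rw [Nat.card_eq_fintype_card]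
  obtain ⟨p, hp⟩ := Function.ne_iff.1 hST
  set q := S p with hq
  set r := T p with hr
  set s := S r with hs
  have hqp : q ≠ p := hSne p
  have hrp : r ≠ p := hTne p
  have hsr : s ≠ r := hSne r
  have hSq : S q = p := hS p
  have hTr : T r = p := hT p
  have hSs : S s = r := hS r
  have hsp : s ≠ p := fun h => hp (by rw [← hSs, h])
  have hsq : s ≠ q := fun h => hrp (hS.injective h)
  have hπq : π q = π p := hπS p
  have hπr : π r = π p := hπT p
  have hπs : π s = π p := (hπS r).trans hπr
  have h4 : 4 ≤ (fib (π p)).card := by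
    refine le_trans (b := ({p, q, r, s} : Finset Y).card) ?_ (Finset.card_le_card ?_)
    · rw [Finset.card_insert_of_notMem, Finset.card_insert_of_notMem, Finset.card_pair hsr.symm]
      · simp [hp, hsq.symm]
      · simp [hqp.symm, hrp.symm, hsp.symm]
    · intro z hz
      simp only [Finset.mem_insert, Finset.mem_singleton] at hz
      rcases hz with rfl | rfl | rfl | rfl <;> simp [fib, *]
  have h5 : ∀ v, v ≠ p → v ≠ q → v ≠ r → v ≠ s → π v = π p → 5 ≤ (fib (π p)).card := by
    intro v h1 h2 h3 h4 hv
    refine le_trans (b := ({v, p, q, r, s} : Finset Y).card) ?_ (Finset.card_le_card ?_)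
    · rw [Finset.card_insert_of_notMem, Finset.card_insert_of_notMem,
        Finset.card_insert_of_notMem, Finset.card_pair hsr.symm]
      · simp [hp, hsq.symm]
      · simp [hqp.symm, hrp.symm, hsp.symm]
      · simp [h1, h2, h3, h4]
    · intro z hz
      simp only [Finset.mem_insert, Finset.mem_singleton] at hz
      rcases hz with rfl | rfl | rfl | rfl | rfl <;> simp [fib, *]
  have hfive : 5 ≤ (fib (π p)).card →
      2 * Fintype.card (Quot fun p q : Y => q = S p ∨ q = T p) + 3 ≤ Fintype.card Y := by
    intro h
    calc _ = ∑ y, (2 + if y = π p then 3 else 0) := by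
          rw [Finset.sum_add_distrib]; simp [mul_comm]
      _ ≤ ∑ y, (fib y).card := Finset.sum_le_sum fun y _ => by
          split_ifs with hy
          · rw [hy]; exact h
          · exact h2 y
      _ = _ := hcard.symm
  -- The component of `p` contains `p`, `q`, `r`, `s`, an excess of 2. If they close up, another
  -- point `u` where `S` and `T` differ must exist: it is a fifth point, or lies in another
  -- component, which then has the three points `u`, `S u`, `T u`. If they do not close up, `T q` is
  -- a fifth point.
  by_cases hTq : T q = s
  · obtain ⟨u, hup, huq, hur, hus, hu⟩ : ∃ u, u ≠ p ∧ u ≠ q ∧ u ≠ r ∧ u ≠ s ∧ T u ≠ S u := by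
      by_contra! hcon
      exact hmove ⟨p, q, r, s, rfl, rfl, hrp, fun h => hp h.symm, rfl, hTq, hcon⟩
    by_cases hπu : π u = π p
    · exact hfive (h5 u hup huq hur hus hπu)
    · have h3 : 3 ≤ (fib (π u)).card := by
        refine le_trans (b := ({u, S u, T u} : Finset Y).card) ?_ (Finset.card_le_card ?_)
        · rw [Finset.card_insert_of_notMem, Finset.card_pair hu.symm]
          simp [(hSne u).symm, (hTne u).symm]
        · intro z hz
          simp only [Finset.mem_insert, Finset.mem_singleton] at hz
          rcases hz with rfl | rfl | rfl <;> simp [fib, *]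
      calc _ = ∑ y, (2 + (if y = π p then 2 else 0) + if y = π u then 1 else 0) := by
            rw [Finset.sum_add_distrib, Finset.sum_add_distrib]; simp [mul_comm]
        _ ≤ ∑ y, (fib y).card := Finset.sum_le_sum fun y _ => by
            split_ifs with hy hy' hy'
            · exact absurd (hy'.symm.trans hy) hπu
            · rw [hy]; exact h4
            · rw [hy']; exact h3
            · exact h2 y
        _ = _ := hcard.symm
  · refine hfive (h5 (T q) (fun h => ?_) (hTne q) (fun h => ?_) hTq ((hπT q).trans hπq))
    · exact hp (by rw [hr, ← h, hT])
    · exact hqp (hT.injective h)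

end ArcMove

/-! ### From the local bound at each crossing to the bound for two states. -/

theorem card_components_prod_le {c m : ℕ} (S T : Fin c → Fin m → Fin m) (k : ℕ)
    (h : ∀ x, Nat.card (Quot fun p q => q = S x p ∨ q = T x p) ≤ k) :
    Nat.card (Quot fun p q : Fin c × Fin m => q = (p.1, S p.1 p.2) ∨ q = (p.1, T p.1 p.2)) ≤
      c * k := by
  let f : (Σ x, Quot fun p q => q = S x p ∨ q = T x p) →
      Quot fun p q : Fin c × Fin m => q = (p.1, S p.1 p.2) ∨ q = (p.1, T p.1 p.2) :=
    fun y => Quot.lift (fun p => Quot.mk _ (y.1, p)) (by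
      rintro p q (rfl | rfl)
      · exact Quot.sound (Or.inl rfl)
      · exact Quot.sound (Or.inr rfl)) y.2
  have hf : Function.Surjective f := by
    intro y
    obtain ⟨⟨x, p⟩, rfl⟩ := Quot.mk_surjective y
    exact ⟨⟨x, Quot.mk _ p⟩, rfl⟩
  calc _ ≤ _ := Nat.card_le_card_of_surjective f hf
    _ = ∑ x, Nat.card (Quot fun p q => q = S x p ∨ q = T x p) := Nat.card_sigma
    _ ≤ ∑ _x : Fin c, k := Finset.sum_le_sum fun x _ => h x
    _ = c * k := by simp

namespace MultiProjection

variable {n c : ℕ}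

/-- The global half of the argument: only the local relation between the two splits at each crossing
matters. -/
theorem components_add_components_le (hn : 3 ≤ n) {P : MultiProjection n c} (hP : P.IsConnected)
    (s s' : P.State)
    (h : ∀ x, (s x).split.partner ≠ (s' x).split.partner ∧
      ¬ ArcMove (s x).split.partner (s' x).split.partner) :
    s.components + s'.components ≤ (2 * n - 4) * c + 2 := by
  let a : Fin c × Fin (2 * n) → Fin c × Fin (2 * n) := fun p => (p.1, (s p.1).split.partner p.2)
  let b : Fin c × Fin (2 * n) → Fin c × Fin (2 * n) := fun p => (p.1, (s' p.1).split.partner p.2)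
  have ha : Function.Involutive a := fun p => by simp [a, (s p.1).split.involutive p.2]
  have hb : Function.Involutive b := fun p => by simp [b, (s' p.1).split.involutive p.2]
  have hna : ∀ p, a p ≠ p := fun p hp => (s p.1).split.ne_self p.2 (congrArg Prod.snd hp)
  have hnb : ∀ p, b p ≠ p := fun p hp => (s' p.1).split.ne_self p.2 (congrArg Prod.snd hp)
  have hgenus := genus_inequality P.edge_involutive ha hb P.edge_ne_self hna hnb
  have hab : Module.finrank (ZMod 2) ↥(invariantFunctions a ⊓ invariantFunctions b) ≤
      c * (n - 2) := by
    rw [finrank_invariantFunctions_inf]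
    refine card_components_prod_le (fun x => (s x).split.partner) (fun x => (s' x).split.partner)
      (n - 2) fun x => ?_
    -- The excess 3 suffices for `n - 2` because the number `2 * n` of endpoints is even.
    have := two_mul_card_components_add_three_le (s x).split.involutive (s' x).split.involutive
      (s x).split.ne_self (s' x).split.ne_self (h x).1 (h x).2
    rw [Fintype.card_fin] at this
    omega
  rw [finrank_invariantFunctions_inf, finrank_invariantFunctions_inf, Fintype.card_prod,
    Fintype.card_fin, Fintype.card_fin] at hgenus
  have hs : s.components = Nat.card (Quot fun p q => q = P.edge p ∨ q = a p) + P.circles := rfl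
  have hs' : s'.components = Nat.card (Quot fun p q => q = P.edge p ∨ q = b p) + P.circles := rfl
  unfold IsConnected at hP
  -- Without crossings, the projection is at most one circle, counted once in each state.
  rcases Nat.eq_zero_or_pos c with rfl | hc
  · have h0 : ∀ r : Fin 0 × Fin (2 * n) → Fin 0 × Fin (2 * n) → Prop, Nat.card (Quot r) = 0 := by
      intro r
      have : IsEmpty (Quot r) := ⟨fun y => (Quot.exists_rep y).elim fun x _ => x.1.elim0⟩
      exact Nat.card_of_isEmpty
    rw [hs, hs', h0, h0]
    omega
  · have hpos : 0 < graphComponents P.edge := by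
      have : Nonempty (Quot fun x y : Fin c => ∃ e e', P.edge (x, e) = (y, e')) :=
        ⟨Quot.mk _ ⟨0, hc⟩⟩
      exact Nat.card_pos
    have hk := finrank_inf_add_le_of_connected (e := P.edge) (a := a) (b := b) (by omega)
      (fun _ => rfl) (fun _ => rfl) (show graphComponents P.edge = 1 by omega)
    obtain ⟨k, rfl⟩ := Nat.exists_eq_add_of_le hn
    have e1 : 2 * (3 + k) - 4 = 2 * k + 2 := by omega
    have e2 : 3 + k - 2 = k + 1 := by omega
    rw [e2] at hab
    rw [e1, hs, hs']
    have hcirc : P.circles = 0 := by omega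
    rw [hcirc]
    -- Half of `hgenus`, twice `hk` and once `hab` add up to the claim.
    nlinarith

end MultiProjection

/-! ### Resolutions of an overstrand as iterated surgeries. -/

namespace ArcMove

variable {Y : Type*} {S T : Y → Y}

/-- The hypothesis on fixed points excludes the degenerate arc `p = q`, for which the reversed move
would not be one. -/
theorem symm (hS : ∀ x, S x = x → T x = x) (h : ArcMove S T) : ArcMove T S := by
  obtain ⟨p, q, r, s, hp, hr, hrp, hrq, hTp, hTq, h⟩ := h
  refine ⟨p, r, q, s, hTp, hTq, ?_, hrq.symm, hp, hr, fun u h1 h2 h3 h4 => (h u h1 h3 h2 h4).symm⟩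
  rintro rfl
  exact hrp (hTp.symm.trans (hS _ hp))

end ArcMove

section Choice

variable {Y : Type*}

/-- The end of the arc at `p` that is met by an `A`-split (`true`) or a `B`-split (`false`). -/
def pick (f : Y → Y) (ε : Bool) (p : Y) : Y := cond ε p (f p)

/-- The power of `A` that belongs to an `A`-split (`true`) or a `B`-split (`false`). -/
def splitSign (ε : Bool) : ℤ := cond ε 1 (-1)

theorem pick_eq_or (f : Y → Y) (ε : Bool) (p : Y) :
    pick f ε p = p ∨ pick f ε p = f p := by cases ε <;> simp [pick]

/-- `Choice f ps xs d`: the list `xs` arises by choosing one end of each arc of `f` that starts at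
a point of `ps`, and `d` is the resulting power of `A`. -/
inductive Choice (f : Y → Y) : List Y → List Y → ℤ → Prop
  | nil : Choice f [] [] 0
  | cons (ε : Bool) (p : Y) {ps xs : List Y} {d : ℤ} (h : Choice f ps xs d) :
      Choice f (p :: ps) (pick f ε p :: xs) (d + splitSign ε)

theorem Choice.congr {f g : Y → Y} {ps xs : List Y} {d : ℤ} (h : Choice f ps xs d)
    (hfg : ∀ p ∈ ps, f p = g p) : Choice g ps xs d := by
  induction h with
  | nil => exact .nil
  | cons ε p h ih =>
    have : pick f ε p = pick g ε p := by simp [pick, hfg p (by simp)]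
    rw [this]
    exact .cons ε p (ih fun q hq => hfg q (by simp [hq]))

theorem Choice.uniform (f : Y → Y) (ε : Bool) (ps : List Y) :
    Choice f ps (ps.map (pick f ε)) (ps.length * splitSign ε) := by
  induction ps with
  | nil => simpa using Choice.nil
  | cons p ps ih =>
    have : (((p :: ps).length : ℕ) : ℤ) * splitSign ε = ps.length * splitSign ε + splitSign ε := by
      push_cast [List.length_cons]; ring
    rw [this]
    exact .cons ε p ih

/-- The points of `ps` are ends of different arcs of `F`, none of which ends at `b`. -/
def DistinctArcs (b : Y) (F : Y → Y) (ps : List Y) : Prop :=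
  ps.Pairwise (fun p p' => p ≠ p' ∧ F p ≠ p') ∧ ∀ p ∈ ps, p ≠ b ∧ p ≠ F b ∧ F p ≠ p

theorem DistinctArcs.pick_ne {b : Y} {F : Y → Y} {p : Y} {ps : List Y}
    (h : DistinctArcs b F (p :: ps)) (hF : Function.Involutive F) (ε : Bool) :
    pick F ε p ≠ b ∧ pick F ε p ≠ F b ∧ F (pick F ε p) ≠ pick F ε p := by
  obtain ⟨h1, h2, h3⟩ := h.2 p (by simp)
  rcases pick_eq_or F ε p with h | h <;> rw [h]
  · exact ⟨h1, h2, h3⟩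
  · exact ⟨fun h => h2 (by rw [← h, hF]), fun h => h1 (hF.injective h),
      fun h => h3 (hF.injective h)⟩

end Choice

section Surgery

variable {Y : Type*} [DecidableEq Y]

/-- Conjugation by the transposition of `b` and `x`. If the involution `F` joins `b` to `c` and
`x` to `y`, then `surger b x F` joins `c` to `x` and `y` to `b`. -/
def surger (b x : Y) (F : Y → Y) : Y → Y := fun u => Equiv.swap b x (F (Equiv.swap b x u))

/-- Iterated surgery. -/
def chain (b : Y) : List Y → (Y → Y) → (Y → Y)
  | [], F => F
  | x :: xs, F => chain b xs (surger b x F)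

theorem chain_append (b : Y) (xs ys : List Y) (F : Y → Y) :
    chain b (xs ++ ys) F = chain b ys (chain b xs F) := by
  induction xs generalizing F with
  | nil => rfl
  | cons x xs ih => exact ih _

theorem surger_surger (b x : Y) (F : Y → Y) : surger b x (surger b x F) = F := by
  funext u
  simp [surger]

theorem surger_involutive {b x : Y} {F : Y → Y} (hF : Function.Involutive F) :
    Function.Involutive (surger b x F) := fun u => by simp [surger, hF _]

theorem chain_involutive {b : Y} {xs : List Y} {F : Y → Y} (hF : Function.Involutive F) :
    Function.Involutive (chain b xs F) := by
  induction xs generalizing F with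
  | nil => exact hF
  | cons x xs ih => exact ih (surger_involutive hF)

theorem surger_apply_of_ne {b x u : Y} {F : Y → Y} (hb : u ≠ b) (hx : u ≠ x) (hFb : F u ≠ b)
    (hFx : F u ≠ x) : surger b x F u = F u := by
  rw [surger, Equiv.swap_apply_of_ne_of_ne hb hx, Equiv.swap_apply_of_ne_of_ne hFb hFx]

theorem surger_apply_left {b x : Y} {F : Y → Y} (hFb : F x ≠ b) (hFx : F x ≠ x) :
    surger b x F b = F x := by
  rw [surger, Equiv.swap_apply_left, Equiv.swap_apply_of_ne_of_ne hFb hFx]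

theorem surger_apply_right {b x : Y} {F : Y → Y} (hFb : F b ≠ b) (hFx : F b ≠ x) :
    surger b x F x = F b := by
  rw [surger, Equiv.swap_apply_right, Equiv.swap_apply_of_ne_of_ne hFb hFx]

theorem surger_apply_of_apply_eq_left {b x c : Y} {F : Y → Y} (hcb : c ≠ b) (hcx : c ≠ x)
    (hc : F c = b) : surger b x F c = x := by
  rw [surger, Equiv.swap_apply_of_ne_of_ne hcb hcx, hc, Equiv.swap_apply_left]

theorem surger_apply_of_apply_eq_right {b x y : Y} {F : Y → Y} (hyb : y ≠ b) (hyx : y ≠ x)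
    (hy : F y = x) : surger b x F y = b := by
  rw [surger, Equiv.swap_apply_of_ne_of_ne hyb hyx, hy, Equiv.swap_apply_right]

theorem surger_apply_eq_self_iff {b x u : Y} {F : Y → Y} (hb : F b ≠ b) (hx : F x ≠ x) :
    surger b x F u = u ↔ F u = u := by
  rw [surger, Equiv.swap_apply_eq_iff]
  by_cases hub : u = b
  · subst hub; simp [hb, hx]
  by_cases hux : u = x
  · subst hux; simp [hb, hx]
  rw [Equiv.swap_apply_of_ne_of_ne hub hux]

/-- Conjugation carries the points of a move to the points of a move. Thus a change at one crossing
persists through the same surgeries at all later ones. -/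
theorem ArcMove.surger {S T : Y → Y} (b x : Y) (h : ArcMove S T) :
    ArcMove (surger b x S) (surger b x T) := by
  obtain ⟨p, q, r, s, hp, hr, hrp, hrq, hTp, hTq, h⟩ := h
  refine ⟨Equiv.swap b x p, Equiv.swap b x q, Equiv.swap b x r, Equiv.swap b x s,
    by simp [_root_.surger, hp], by simp [_root_.surger, hr], by simpa, by simpa,
    by simp [_root_.surger, hTp], by simp [_root_.surger, hTq], fun u h1 h2 h3 h4 => ?_⟩
  rw [_root_.surger, _root_.surger, h] <;> rwa [Ne, Equiv.swap_apply_eq_iff]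

theorem ArcMove.chain {S T : Y → Y} (b : Y) (xs : List Y) (h : ArcMove S T) :
    ArcMove (chain b xs S) (chain b xs T) := by
  induction xs generalizing S T with
  | nil => exact h
  | cons x xs ih => exact ih (h.surger b x)

/-- The two surgeries at one crossing differ by a move. -/
theorem arcMove_surger_surger {b x : Y} {F : Y → Y} (hF : Function.Involutive F)
    (hb : F b ≠ b) (hx : F x ≠ x) (hxb : x ≠ b) (hxc : x ≠ F b) :
    ArcMove (surger b x F) (surger b (F x) F) := by
  have hyb : F x ≠ b := fun h => hxc (by rw [← h, hF])
  have hyc : F x ≠ F b := fun h => hxb (hF.injective h)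
  have hFF := hF x
  have hFb := hF b
  -- One surgery creates the arcs `F b – x` and `F x – b`, the other `F b – F x` and `x – b`.
  refine ⟨F b, x, F x, b, surger_apply_of_apply_eq_left hb hxc.symm hFb,
    surger_apply_of_apply_eq_right hyb hx hFF, hyc, hx,
    surger_apply_of_apply_eq_left hb hyc.symm hFb,
    surger_apply_of_apply_eq_right hxb hx.symm rfl, fun u h1 h2 h3 h4 => ?_⟩
  have h5 : F u ≠ b := fun h => h1 (by rw [← h, hF])
  have h6 : F u ≠ x := fun h => h3 (by rw [← h, hF])
  have h7 : F u ≠ F x := fun h => h2 (hF.injective h)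
  rw [surger_apply_of_ne h4 h2 h5 h6, surger_apply_of_ne h4 h3 h5 h7]

/-- Surgery may be performed from either end of the arc from `b`. -/
theorem surger_eq_surger_apply {b x : Y} {F : Y → Y} (hF : Function.Involutive F)
    (hb : F b ≠ b) (hx : F x ≠ x) (hxb : x ≠ b) (hxc : x ≠ F b) :
    surger b x F = surger (F b) (F x) F := by
  have hyb : F x ≠ b := fun h => hxc (by rw [← h, hF])
  have hyc : F x ≠ F b := fun h => hxb (hF.injective h)
  have hFF := hF x
  have hFb := hF b
  funext u
  by_cases h1 : u = b
  · rw [h1, surger_apply_left hyb hx, surger_apply_of_apply_eq_left hb.symm hyb.symm rfl]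
  by_cases h2 : u = x
  · rw [h2, surger_apply_right hb hxc.symm, surger_apply_of_apply_eq_right hxc hx.symm rfl]
  by_cases h3 : u = F b
  · rw [h3, surger_apply_of_apply_eq_left hb hxc.symm hFb,
      surger_apply_left (by rwa [hFF]) (by rw [hFF]; exact hx.symm), hFF]
  by_cases h4 : u = F x
  · rw [h4, surger_apply_of_apply_eq_right hyb hx hFF,
      surger_apply_right (by rw [hFb]; exact hb.symm) (by rw [hFb]; exact hyb.symm), hFb]
  have h5 : F u ≠ b := fun h => h3 (by rw [← h, hF])
  have h6 : F u ≠ x := fun h => h4 (by rw [← h, hF])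
  rw [surger_apply_of_ne h1 h2 h5 h6, surger_apply_of_ne h3 h4
    (fun h => h1 (hF.injective h)) fun h => h2 (hF.injective h)]

theorem DistinctArcs.surger_apply {b : Y} {F : Y → Y} {p : Y} {ps : List Y}
    (h : DistinctArcs b F (p :: ps)) (hF : Function.Involutive F) (ε : Bool) :
    ∀ p' ∈ ps, surger b (pick F ε p) F p' = F p' := by
  intro p' hp'
  obtain ⟨h1, h2⟩ := (List.pairwise_cons.1 h.1).1 p' hp'
  obtain ⟨h3, h4, h5⟩ := h.2 p' (by simp [hp'])
  have h6 : F p' ≠ b := fun h => h4 (by rw [← h, hF])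
  have h7 : F p' ≠ p := fun h => h2 (by rw [← h, hF])
  have h8 : F p' ≠ F p := fun h => h1 (hF.injective h).symm
  apply surger_apply_of_ne h3 _ h6
  · rcases pick_eq_or F ε p with h | h <;> rwa [h]
  · rcases pick_eq_or F ε p with h | h <;> rw [h]
    exacts [h1.symm, h2.symm]

theorem DistinctArcs.surger {b : Y} {F : Y → Y} {p : Y} {ps : List Y}
    (h : DistinctArcs b F (p :: ps)) (hF : Function.Involutive F) (ε : Bool) :
    DistinctArcs b (surger b (pick F ε p) F) ps := by
  have happ := h.surger_apply hF ε
  obtain ⟨h1, h2, h3⟩ := h.pick_ne hF ε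
  have hb : _root_.surger b (pick F ε p) F b = F (pick F ε p) :=
    surger_apply_left (fun h => h2 (by rw [← h, hF])) h3
  have hhead := (List.pairwise_cons.1 h.1).1
  refine ⟨(List.pairwise_cons.1 h.1).2.imp_of_mem fun {q q'} hq _ hqq' => ?_, fun q hq => ?_⟩
  · rwa [happ q hq]
  · obtain ⟨h4, -, h5⟩ := h.2 q (by simp [hq])
    refine ⟨h4, ?_, by rwa [happ q hq]⟩
    rw [hb]
    rcases pick_eq_or F ε p with h | h <;> rw [h]
    · exact (hhead q hq).2.symm
    · rw [hF]; exact (hhead q hq).1.symm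

/-- Only the choice of `ε` at every crossing cannot be improved in the direction `ε`. -/
theorem Choice.eq_uniform_or_exists {b : Y} {F : Y → Y} {ps xs : List Y} {d : ℤ} (ε : Bool)
    (h : Choice F ps xs d) (hF : Function.Involutive F) (hb : F b ≠ b)
    (hps : DistinctArcs b F ps) :
    (xs = ps.map (pick F ε) ∧ d = ps.length * splitSign ε) ∨
      ∃ xs', Choice F ps xs' (d + 2 * splitSign ε) ∧ ArcMove (chain b xs F) (chain b xs' F) := by
  induction ps generalizing F xs d with
  | nil =>
    cases h
    simp
  | cons p ps ih =>
    rcases h with _ | ⟨δ, _, h⟩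
    rename_i xs d
    have happ := hps.surger_apply hF δ
    obtain ⟨h1, h2, h3⟩ := hps.pick_ne hF δ
    by_cases hδ : δ = ε
    · subst hδ
      rcases ih (h.congr fun q hq => (happ q hq).symm) (surger_involutive hF)
          (by rwa [Ne, surger_apply_eq_self_iff hb h3])
          (hps.surger hF δ) with ⟨h5, h6⟩ | ⟨xs', h5, h6⟩
      · left
        constructor
        · rw [h5, List.map_cons, List.map_congr_left fun q hq => ?_]
          exact congrArg (cond δ q) (happ q hq)
        · rw [h6]; push_cast [List.length_cons]; ring
      · right
        refine ⟨pick F δ p :: xs', ?_, h6⟩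
        have := Choice.cons δ p (h5.congr happ)
        rwa [add_right_comm] at this
    · right
      -- At the first crossing resolved against `ε`, flipping the choice changes the power by `2 *
      -- splitSign ε`. The two surgeries differ by a move, which the later surgeries conjugate.
      have hpick : pick F ε p = F (pick F δ p) := by
        cases δ <;> cases ε <;> simp_all [pick, hF p]
      have hsign : splitSign δ + 2 * splitSign ε = splitSign ε := by
        cases δ <;> cases ε <;> simp_all [splitSign]
      refine ⟨pick F ε p :: xs, ?_, ?_⟩
      · rw [add_assoc, hsign]
        exact .cons ε p h
      · rw [hpick]
        exact (arcMove_surger_surger hF hb h3 h1 h2).chain b xs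

end Surgery

namespace MultiSkein

variable {n : ℕ}

theorem join_apply_right (f : Fin (2 * n) → Fin (2 * n)) (x y : Fin (2 * n)) :
    join f x y y = x := by simp [join]

theorem join_apply_left (f : Fin (2 * n) → Fin (2 * n)) (x y : Fin (2 * n)) :
    join f x y x = y := by
  by_cases h : x = y
  · simp [join, h]
  · simp [join, h]

theorem join_apply_of_ne {f : Fin (2 * n) → Fin (2 * n)} {x y u : Fin (2 * n)} (hx : u ≠ x)
    (hy : u ≠ y) : join f x y u = f u := by simp [join, hx, hy]

/-- Halfway through `resolve` the arcs need not form an involution. Adding the unresolved rest `c –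
b` of the overstrand repairs this, and either way of resolving the next crossing becomes a surgery
at `b`. -/
theorem join_join_eq_surger {f : Fin (2 * n) → Fin (2 * n)} {b c p : Fin (2 * n)}
    (hF : Function.Involutive (join f c b)) (hpb : p ≠ b) (hpc : p ≠ c) (hp : f p ≠ p)
    (hcb : c ≠ b) :
    join (join f c p) (f p) b = surger b p (join f c b) ∧
      join (join f c (f p)) p b = surger b (f p) (join f c b) := by
  set F := join f c b with hFdef
  have hFb : F b = c := join_apply_right ..
  have hFc : F c = b := join_apply_left ..
  have hFu : ∀ u, u ≠ b → u ≠ c → F u = f u := fun u h1 h2 => join_apply_of_ne h2 h1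
  have hFp := hFu p hpb hpc
  rw [← hFp] at hp ⊢
  have hqb : F p ≠ b := fun h => hpc (by rw [← hFb, ← h, hF])
  have hqc : F p ≠ c := fun h => hpb (by rw [← hFc, ← h, hF])
  have hFq := hF p
  have key : ∀ x y, x ≠ b → x ≠ c → y ≠ b → y ≠ c → F x = y → F y = x → x ≠ y →
      join (join f c x) y b = surger b x F := by
    intro x y hxb hxc hyb hyc hx hy hxy
    funext u
    by_cases h1 : u = b
    · rw [h1, surger_apply_left (by rwa [hx]) (by rw [hx]; exact hxy.symm), hx]
      rw [join_apply_right]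
    by_cases h2 : u = x
    · rw [h2, surger_apply_right (by rwa [hFb]) (by rw [hFb]; exact hxc.symm), hFb]
      rw [join_apply_of_ne hxy hxb, join_apply_right]
    by_cases h3 : u = c
    · rw [h3, surger_apply_of_apply_eq_left hcb hxc.symm hFc]
      rw [join_apply_of_ne hyc.symm hcb, join_apply_left]
    by_cases h4 : u = y
    · rw [h4, surger_apply_of_apply_eq_right hyb hxy.symm hy]
      rw [join_apply_left]
    have h5 : F u ≠ b := fun h => h3 (by rw [← hFb, ← h, hF])
    have h6 : F u ≠ x := fun h => h4 (by rw [← hx, ← h, hF])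
    rw [surger_apply_of_ne h1 h2 h5 h6, hFu u h1 h3, join_apply_of_ne h4 h1,
      join_apply_of_ne h3 h2]
  exact ⟨key _ _ hpb hpc hqb hqc rfl hFq hp.symm, key _ _ hqb hqc hpb hpc hFq rfl hp⟩

theorem mem_resolve {b c : Fin (2 * n)} {ps : List (Fin (2 * n))} {f G : Fin (2 * n) → Fin (2 * n)}
    {t u : ℤ} (hF : Function.Involutive (join f c b)) (hcb : c ≠ b)
    (hps : DistinctArcs b (join f c b) ps) :
    (G, u) ∈ resolve b ps c (f, t) ↔
      ∃ xs d, Choice (join f c b) ps xs d ∧ u = t + d ∧ G = chain b xs (join f c b) := by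
  induction ps generalizing f c t with
  | nil =>
    constructor
    · intro h
      simp only [resolve, List.mem_singleton, Prod.mk.injEq] at h
      exact ⟨[], 0, .nil, by simp [h.2], h.1⟩
    · rintro ⟨xs, d, h, rfl, rfl⟩
      cases h
      simp [resolve, chain]
  | cons p ps ih =>
    have hFb : join f c b b = c := join_apply_right ..
    have hFc : join f c b c = b := join_apply_left ..
    obtain ⟨hpb, hpc, hp⟩ := hps.2 p (by simp)
    rw [hFb] at hpc
    have hFp : join f c b p = f p := join_apply_of_ne hpc hpb
    obtain ⟨e1, e2⟩ := join_join_eq_surger hF hpb hpc (by rwa [← hFp]) hcb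
    have hqb : f p ≠ b := by
      rw [← hFp]; exact fun h => hpc ((hF p).symm.trans (by rw [h, hFb]))
    have key : ∀ ε t', (∃ xs d, Choice (surger b (pick (join f c b) ε p) (join f c b)) ps xs d ∧
          u = t' + splitSign ε + d ∧
          G = chain b xs (surger b (pick (join f c b) ε p) (join f c b))) ↔
        ∃ xs d, Choice (join f c b) ps xs d ∧ u = t' + (d + splitSign ε) ∧
          G = chain b (pick (join f c b) ε p :: xs) (join f c b) := by
      intro ε t'
      have happ := hps.surger_apply hF ε
      constructor
      · rintro ⟨xs, d, h1, h2, h3⟩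
        exact ⟨xs, d, h1.congr happ, by rw [h2]; ring, h3⟩
      · rintro ⟨xs, d, h1, h2, h3⟩
        exact ⟨xs, d, h1.congr fun q hq => (happ q hq).symm, by rw [h2]; ring, h3⟩
    have hA := hps.surger hF true
    have hB := hps.surger hF false
    have kA := key true t
    have kB := key false t
    simp only [pick, cond_true, cond_false, hFp, splitSign] at hA hB kA kB
    rw [resolve, List.mem_append, ih (by rw [e1]; exact surger_involutive hF) hqb (by rwa [e1]),
      ih (by rw [e2]; exact surger_involutive hF) hpb (by rwa [e2]), e1, e2, sub_eq_add_neg, kA, kB]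
    constructor
    · rintro (⟨xs, d, h1, h2, h3⟩ | ⟨xs, d, h1, h2, h3⟩)
      · exact ⟨_, _, .cons true p h1, h2, h3⟩
      · refine ⟨_, _, .cons false p h1, h2, ?_⟩
        simpa only [pick, cond_false, hFp] using h3
    · rintro ⟨_, _, h1, h2, h3⟩
      rcases h1 with _ | ⟨ε, _, h1⟩
      cases ε
      · right
        simp only [pick, cond_false, hFp] at h3
        exact ⟨_, _, h1, h2, h3⟩
      · left
        exact ⟨_, _, h1, h2, h3⟩

end MultiSkein

/-! ### Crossings of arcs in a disk, and why resolutions have none. -/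

/-- The arcs `a – b` and `x – y` cross if they are drawn inside a circle. -/
def ArcsCross (a b x y : ℕ) : Prop :=
  ¬ ((a < x ∧ x < b ∨ b < x ∧ x < a) ↔ (a < y ∧ y < b ∨ b < y ∧ y < a))

theorem ArcsCross.swap {a b x y : ℕ} (h : ArcsCross a b x y) : ArcsCross a b y x := by
  unfold ArcsCross at *; tauto

theorem ArcsCross.comm {a b x y : ℕ} (h1 : a ≠ x) (h2 : a ≠ y) (h3 : b ≠ x) (h4 : b ≠ y)
    (h : ArcsCross a b x y) : ArcsCross x y a b := by
  unfold ArcsCross at *; omega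

theorem ArcsCross.comm_left {a b x y : ℕ} (h : ArcsCross a b x y) : ArcsCross b a x y := by
  unfold ArcsCross at *; omega

/-- For a fixed arc `a – b`, crossing means that `x` and `y` lie on different sides; as there are
only two sides, such relations compose by parity. -/
theorem ArcsCross.trans_not {a b x y z : ℕ} (h : ArcsCross a b x y) (h' : ¬ ArcsCross a b y z) :
    ArcsCross a b x z := by
  have key : ∀ {p q r : Prop}, ¬ (p ↔ q) → ¬ ¬ (q ↔ r) → ¬ (p ↔ r) := by tauto
  exact key h h'

theorem ArcsCross.trans {a b x y z : ℕ} (h : ArcsCross a b x y) (h' : ArcsCross a b y z) :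
    ¬ ArcsCross a b x z := by
  have key : ∀ {p q r : Prop}, ¬ (p ↔ q) → ¬ (q ↔ r) → ¬ ¬ (p ↔ r) := by tauto
  exact key h h'

theorem not_arcsCross_of_separated {a b x y u v : ℕ} (hau : a ≠ u) (hav : a ≠ v) (hbu : b ≠ u)
    (hbv : b ≠ v) (hxu : x ≠ u) (hxv : x ≠ v) (hyu : y ≠ u) (hyv : y ≠ v)
    (h1 : ¬ ArcsCross u v a b) (h2 : ¬ ArcsCross u v x y) (h3 : ArcsCross u v a x) :
    ¬ ArcsCross a b x y := by
  wlog huv : u ≤ v generalizing u v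
  · exact this hav hau hbv hbu hxv hxu hyv hyu (mt ArcsCross.comm_left h1)
      (mt ArcsCross.comm_left h2) h3.comm_left (by omega)
  unfold ArcsCross at *
  by_cases ha : u < a ∧ a < v
  · have hb : u < b ∧ b < v := by omega
    have hx : ¬ (u < x ∧ x < v) := by omega
    have hy : ¬ (u < y ∧ y < v) := by omega
    clear h1 h2 h3
    omega
  · have hb : ¬ (u < b ∧ b < v) := by omega
    have hx : (u < x ∧ x < v) := by omega
    have hy : (u < y ∧ y < v) := by omega
    clear h1 h2 h3
    omega

/-- The arc `c – x` stays on the side of `x – y` where `c` lies, and `u – v` stays on the other. -/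
theorem not_arcsCross_of_same_side {c x y u v : ℕ} (hux : u ≠ x) (huy : u ≠ y)
    (hvx : v ≠ x) (hvy : v ≠ y) (hcx : c ≠ x) (hcy : c ≠ y)
    (h1 : ArcsCross x y c u) (h2 : ArcsCross x y c v) : ¬ ArcsCross u v c x := by
  wlog hxy : x ≤ y generalizing x y
  · intro h
    refine this huy hux hvy hvx hcy hcx h1.comm_left h2.comm_left (by omega) (h.trans_not fun h => ?_)
    exact h1.swap.trans h2 (h.comm hux huy hvx hvy)
  unfold ArcsCross at *
  by_cases hc : x < c ∧ c < y
  · have hu : ¬ (x < u ∧ u < y) := by omega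
    have hv : ¬ (x < v ∧ v < y) := by omega
    clear h1 h2
    omega
  · have hu : (x < u ∧ u < y) := by omega
    have hv : (x < v ∧ v < y) := by omega
    clear h1 h2
    omega

theorem ArcsCross.not_of_surgery {b c x y : ℕ} (hcy : c ≠ y) (hxy : x ≠ y)
    (h : ArcsCross b c x y) : ¬ ArcsCross b y c x := by
  unfold ArcsCross at *
  omega

/-- The effect of a surgery that joins `c` to `x` and `b` to `y` on the crossings with `u – v`, if
either `u – v` does not cross `b – c` or `x – y` lies between `c` and `u – v`. -/
theorem arcsCross_surgery {b c x y u v : ℕ} (hbx : b ≠ x) (hby : b ≠ y)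
    (hcx : c ≠ x) (hcy : c ≠ y) (hub : u ≠ b) (huc : u ≠ c) (hux : u ≠ x) (huy : u ≠ y)
    (hvb : v ≠ b) (hvc : v ≠ c) (hvx : v ≠ x) (hvy : v ≠ y)
    (hxyuv : ¬ ArcsCross x y u v) (hbcxy : ArcsCross b c x y)
    (h : ArcsCross b c u v → ¬ ArcsCross x y b u) :
    ¬ ArcsCross c x u v ∧ (ArcsCross b y u v ↔ ArcsCross b c u v) := by
  -- If `u – v` crosses `b – c`, it lies on the side of `x – y` away from `c`. It then misses `c –
  -- x`, so that `c`, `x` and `y` lie on one side of `u – v` and `b` on the other.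
  by_cases hcr : ArcsCross b c u v
  · have h1 : ArcsCross x y c u := (hbcxy.comm hbx hby hcx hcy).swap.trans_not (h hcr)
    have h2 : ArcsCross x y c v := h1.trans_not hxyuv
    have h3 := not_arcsCross_of_same_side hux huy hvx hvy hcx hcy h1 h2
    refine ⟨fun h => h3 (h.comm huc.symm hvc.symm hux.symm hvx.symm), iff_of_true ?_ hcr⟩
    have h4 : ArcsCross u v b c := hcr.comm hub.symm hvb.symm huc.symm hvc.symm
    have h5 : ArcsCross u v b x := h4.trans_not h3
    have h6 : ¬ ArcsCross u v x y := fun h => hxyuv (h.comm hux huy hvx hvy)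
    exact (h5.trans_not h6).comm hub huy hvb hvy
  -- Otherwise `u – v` crosses neither of the arcs `b – c` and `x – y`. As these cross each other,
  -- all four ends lie on one side of `u – v`.
  · have h1 : ¬ ArcsCross u v b c := fun h => hcr (h.comm hub huc hvb hvc)
    have h2 : ¬ ArcsCross u v x y := fun h => hxyuv (h.comm hux huy hvx hvy)
    have h3 : ¬ ArcsCross u v b x := fun h => not_arcsCross_of_separated hub.symm hvb.symm huc.symm
      hvc.symm hux.symm hvx.symm huy.symm hvy.symm h1 h2 h hbcxy
    refine ⟨fun h => ?_, iff_of_false (fun h => ?_) hcr⟩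
    · have h4 : ArcsCross u v c x := h.comm huc.symm hvc.symm hux.symm hvx.symm
      exact h3 (h4.swap.trans_not fun h => h1 h.swap).swap
    · have h4 : ArcsCross u v b y := h.comm hub.symm hvb.symm huy.symm hvy.symm
      exact h3 (h4.trans_not fun h => h2 h.swap)

/-- No two arcs of `f` cross. -/
def IsNoncrossing {m : ℕ} (f : Fin m → Fin m) : Prop :=
  ∀ u v, u ≠ v → f u ≠ v → ¬ ArcsCross u (f u) v (f v)

/-- The arc of `F` from `b` crosses precisely the arcs at the points of `ps`, in this order, and no
other arcs of `F` cross. -/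
structure CrossesOnly {m : ℕ} (b : Fin m) (F : Fin m → Fin m) (ps : List (Fin m)) : Prop where
  noncrossing : ∀ u v, u ≠ b → u ≠ F b → v ≠ b → v ≠ F b → u ≠ v → F u ≠ v →
    ¬ ArcsCross u (F u) v (F v)
  cross : ∀ p ∈ ps, ArcsCross b (F b) p (F p)
  mem : ∀ u, u ≠ b → u ≠ F b → ArcsCross b (F b) u (F u) → u ∈ ps ∨ F u ∈ ps
  sorted : ps.Pairwise fun p p' : Fin m => ¬ ArcsCross p (F p) b p'

namespace CrossesOnly

variable {m : ℕ} {b p : Fin m} {F : Fin m → Fin m} {ps : List (Fin m)}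

theorem isNoncrossing (h : CrossesOnly b F []) (hF : Function.Involutive F) : IsNoncrossing F := by
  intro u v huv hFuv hcr
  have hval : ∀ {x y : Fin m}, x ≠ y → (x : ℕ) ≠ y := fun h h' => h (Fin.ext h')
  have hFF : F u ≠ F v := fun h => huv (hF.injective h)
  have hFv : u ≠ F v := fun h => hFuv (by rw [h, hF])
  have hbm : ∀ w, w ≠ b → w ≠ F b → ¬ ArcsCross b (F b) w (F w) := fun w h1 h2 h3 => by
    simpa using h.mem w h1 h2 h3
  have hcr' : ArcsCross v (F v) u (F u) :=
    hcr.comm (hval huv) (hval hFv) (hval hFuv) (hval hFF)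
  by_cases h1 : u = b
  · subst h1
    exact hbm v huv.symm hFuv.symm hcr
  by_cases h2 : u = F b
  · subst h2
    rw [hF] at hcr hFuv
    exact hbm v hFuv.symm huv.symm hcr.comm_left
  by_cases h3 : v = b
  · subst h3
    exact hbm u h1 h2 hcr'
  by_cases h4 : v = F b
  · subst h4
    rw [hF] at hcr'
    exact hbm u h1 h2 hcr'.comm_left
  exact h.noncrossing u v h1 h2 h3 h4 huv hFuv hcr

/-- The first crossing along the overstrand is removed: the piece `F b – x` cut off there meets
nothing, since no other arc comes before, and the rest `b – F x` meets exactly the arcs still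
listed. -/
theorem surger (h : CrossesOnly b F (p :: ps)) (hF : Function.Involutive F)
    (hps : DistinctArcs b F (p :: ps)) (ε : Bool) :
    CrossesOnly b (surger b (pick F ε p) F) ps := by
  have hval : ∀ {x y : Fin m}, x ≠ y → (x : ℕ) ≠ y := fun h h' => h (Fin.ext h')
  have happ := hps.surger_apply hF ε
  obtain ⟨hxb, hxc, hx⟩ := hps.pick_ne hF ε
  obtain ⟨hpb, hpc, hp⟩ := hps.2 p (by simp)
  have hxp := pick_eq_or F ε p
  set x := pick F ε p with hxdef
  have hyb : F x ≠ b := fun h => hxc (by rw [← h, hF])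
  have hyc : F x ≠ F b := fun h => hxb (hF.injective h)
  have hpx : p = x ∨ p = F x := by
    rcases hxp with h | h
    · exact Or.inl h.symm
    · exact Or.inr (by rw [h, hF])
  have hcrx : ∀ a c : ℕ, ArcsCross a c x (F x) ↔ ArcsCross a c p (F p) := by
    rcases hpx with h | h <;> rw [h]
    · simp
    · rw [hF]; exact fun a c => ⟨ArcsCross.swap, ArcsCross.swap⟩
  have hcrx' : ∀ a c : ℕ, ArcsCross x (F x) a c ↔ ArcsCross p (F p) a c := by
    rcases hpx with h | h <;> rw [h]
    · simp
    · rw [hF]; exact fun a c => ⟨ArcsCross.comm_left, ArcsCross.comm_left⟩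
  have hbc : b ≠ F b := by
    intro hb
    have := h.cross p (by simp)
    rw [← hb] at this
    unfold ArcsCross at this
    omega
  have key : ∀ v, v ≠ b → v ≠ F b → v ≠ x → v ≠ F x → ¬ ArcsCross (F b) x v (F v) ∧
      (ArcsCross b (F x) v (F v) ↔ ArcsCross b (F b) v (F v)) := by
    intro v hvb hvc hvx hvy
    have h1 : F v ≠ b := fun h => hvc (by rw [← h, hF])
    have h2 : F v ≠ F b := fun h => hvb (hF.injective h)
    have h3 : F v ≠ x := fun h => hvy (by rw [← h, hF])
    have h4 : F v ≠ F x := fun h => hvx (hF.injective h)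
    have h5 : ¬ ArcsCross x (F x) v (F v) := h.noncrossing x v hxb hxc hvb hvc hvx.symm hvy.symm
    refine arcsCross_surgery (hval hxb.symm) (hval hyb.symm) (hval hxc.symm) (hval hyc.symm)
      (hval hvb) (hval hvc) (hval hvx) (hval hvy) (hval h1) (hval h2) (hval h3) (hval h4) h5
      ((hcrx _ _).2 (h.cross p (by simp))) fun hcr => ?_
    have h6 := (List.pairwise_cons.1 h.sorted).1
    have hpv : v ≠ p := by rcases hpx with h | h <;> rwa [h]
    have hpv' : F v ≠ p := by rcases hpx with h | h <;> rwa [h]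
    rw [hcrx']
    rcases h.mem v hvb hvc hcr with hv | hv
    · exact h6 v ((List.mem_cons.1 hv).resolve_left hpv)
    · intro h7
      refine h6 _ ((List.mem_cons.1 hv).resolve_left hpv') (h7.trans_not ?_)
      rwa [← hcrx']
  have hcx : ¬ ArcsCross b (F x) (F b) x :=
    ((hcrx _ _).2 (h.cross p (by simp))).not_of_surgery (hval hyc.symm) (hval hx.symm)
  have hGb : _root_.surger b x F b = F x := surger_apply_left hyb hx
  have hGy : _root_.surger b x F (F x) = b := surger_apply_of_apply_eq_right hyb hx (hF x)
  have hGx : _root_.surger b x F x = F b := surger_apply_right hbc.symm hxc.symm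
  have hGc : _root_.surger b x F (F b) = x :=
    surger_apply_of_apply_eq_left hbc.symm hxc.symm (hF b)
  have hG : ∀ v, v ≠ b → v ≠ F b → v ≠ x → v ≠ F x → _root_.surger b x F v = F v :=
    fun v h1 h2 h3 h4 => surger_apply_of_ne h1 h3 (fun h => h2 (by rw [← h, hF]))
      fun h => h4 (by rw [← h, hF])
  refine ⟨fun u v hub huy hvb hvy huv hGuv => ?_, fun q hq => ?_, fun u hub huy hcr => ?_, ?_⟩
  · rw [hGb] at huy hvy
    have hstep : ∀ v, v ≠ b → v ≠ F x → v ≠ F b → v ≠ x →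
        ¬ ArcsCross v (F v) (F b) x ∧ ¬ ArcsCross v (F v) x (F b) := by
      intro v hvb hvy hvc hvx
      have h1 : F v ≠ F b := fun h => hvb (hF.injective h)
      have h2 : F v ≠ x := fun h => hvy (by rw [← h, hF])
      have h3 : ¬ ArcsCross v (F v) (F b) x := fun h => (key v hvb hvc hvx hvy).1
        (h.comm (hval hvc) (hval hvx) (hval h1) (hval h2))
      exact ⟨h3, fun h => h3 h.swap⟩
    by_cases huc : u = F b
    · subst huc
      rw [hGc] at hGuv ⊢
      rw [hG v hvb huv.symm hGuv.symm hvy]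
      exact (key v hvb huv.symm hGuv.symm hvy).1
    by_cases hux : u = x
    · rw [hux] at hGuv huv ⊢
      rw [hGx] at hGuv ⊢
      rw [hG v hvb hGuv.symm huv.symm hvy]
      exact fun h => (key v hvb hGuv.symm huv.symm hvy).1 h.comm_left
    rw [hG u hub huc hux huy] at hGuv ⊢
    by_cases hvc : v = F b
    · subst hvc
      rw [hGc]
      exact (hstep u hub huy huc hux).1
    by_cases hvx : v = x
    · rw [hvx, hGx]
      exact (hstep u hub huy huc hux).2
    rw [hG v hvb hvc hvx hvy]
    exact h.noncrossing u v hub huc hvb hvc huv hGuv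
  · obtain ⟨h1, h2⟩ := (List.pairwise_cons.1 hps.1).1 q hq
    obtain ⟨h3, h4, -⟩ := hps.2 q (by simp [hq])
    rw [hGb, happ q hq]
    refine (key q h3 h4 ?_ ?_).2.2 (h.cross q (by simp [hq]))
    · rcases hxp with h | h <;> rw [h]
      exacts [h1.symm, h2.symm]
    · rcases hxp with h | h <;> rw [h]
      exacts [h2.symm, by rw [hF]; exact h1.symm]
  · rw [hGb] at huy hcr
    by_cases huc : u = F b
    · subst huc
      rw [hGc] at hcr
      exact absurd hcr hcx
    by_cases hux : u = x
    · rw [hux, hGx] at hcr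
      exact absurd hcr.swap hcx
    rw [hG u hub huc hux huy] at hcr ⊢
    have hpu : u ≠ p := by rcases hpx with h | h <;> rwa [h]
    have hpu' : F u ≠ p := by
      rcases hpx with h | h <;> rw [h]
      · exact fun h => huy (by rw [← h, hF])
      · exact fun h => hux (hF.injective h)
    rcases h.mem u hub huc ((key u hub huc hux huy).2.1 hcr) with hu | hu
    · exact Or.inl ((List.mem_cons.1 hu).resolve_left hpu)
    · exact Or.inr ((List.mem_cons.1 hu).resolve_left hpu')
  · exact (List.pairwise_cons.1 h.sorted).2.imp_of_mem fun hq _ hqq' => by rwa [happ _ hq]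

/-- This makes every resolution a genuine split, so that the results of flipping or lifting moves
are terms of the skein relation. -/
theorem chain {xs : List (Fin m)} {d : ℤ} (h : CrossesOnly b F ps) (hF : Function.Involutive F)
    (hps : DistinctArcs b F ps) (hxs : Choice F ps xs d) : IsNoncrossing (chain b xs F) := by
  induction ps generalizing F xs d with
  | nil =>
    cases hxs
    exact h.isNoncrossing hF
  | cons p ps ih =>
    rcases hxs with _ | ⟨ε, _, hxs⟩
    exact ih (F := _root_.surger b (pick F ε p) F) (h.surger hF hps ε) (surger_involutive hF) (hps.surger hF ε)
      (hxs.congr fun q hq => (hps.surger_apply hF ε q hq).symm)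

end CrossesOnly

/-! ### Partial resolutions and extreme ones. -/

namespace MultiSkein

variable {n : ℕ}

/-- All resolutions of the strands in `l`, laid one over the other. -/
def lay (l : List (Fin n)) : List ((Fin (2 * n) → Fin (2 * n)) × ℤ) :=
  l.foldl (fun L i => L.flatMap (addOverstrand i)) [(id, 0)]

theorem resolutions_eq_lay (σ : Equiv.Perm (Fin n)) :
    resolutions σ = lay ((List.finRange n).map σ) := by
  rw [lay, List.foldl_map]
  rfl

theorem mem_lay_append {l : List (Fin n)} {i : Fin n} {T : (Fin (2 * n) → Fin (2 * n)) × ℤ} :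
    T ∈ lay (l ++ [i]) ↔ ∃ T' ∈ lay l, T ∈ addOverstrand i T' := by
  rw [lay, List.foldl_append, List.foldl_cons, List.foldl_nil, List.mem_flatMap]
  rfl

/-- The endpoints on the clockwise side from the start to the end of strand `i`. -/
def IsLeft (i : Fin n) (u : Fin (2 * n)) : Prop := strandStart i < u ∧ u < strandEnd i

theorem strandStart_ne_strandEnd (i j : Fin n) : strandStart i ≠ strandEnd j := by
  have := i.2
  simp only [strandStart, strandEnd, ne_eq, Fin.mk.injEq]
  omega

theorem strandStart_injective : Function.Injective (strandStart : Fin n → Fin (2 * n)) := by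
  intro i j h
  simpa [strandStart, Fin.ext_iff] using h

theorem strandEnd_injective : Function.Injective (strandEnd : Fin n → Fin (2 * n)) := by
  intro i j h
  simpa [strandEnd, Fin.ext_iff] using h

theorem IsLeft.ne_start {i : Fin n} {u : Fin (2 * n)} (h : IsLeft i u) : u ≠ strandStart i :=
  h.1.ne'

theorem IsLeft.ne_end {i : Fin n} {u : Fin (2 * n)} (h : IsLeft i u) : u ≠ strandEnd i :=
  h.2.ne

theorem mem_crossed {f : Fin (2 * n) → Fin (2 * n)} {i : Fin n} {u : Fin (2 * n)} :
    u ∈ crossed f i ↔ IsLeft i u ∧ ¬ IsLeft i (f u) := by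
  simp only [crossed, IsLeft, List.mem_filter, List.mem_finRange, true_and, decide_eq_true_eq]

theorem crossed_sorted (f : Fin (2 * n) → Fin (2 * n)) (i : Fin n) :
    (crossed f i).Pairwise (· < ·) :=
  (List.pairwise_lt_finRange _).filter _

theorem crossed_eq {f : Fin (2 * n) → Fin (2 * n)} {i : Fin n} {ps : List (Fin (2 * n))}
    (hs : ps.Pairwise (· < ·)) (h : ∀ u, u ∈ ps ↔ IsLeft i u ∧ ¬ IsLeft i (f u)) :
    crossed f i = ps := by
  refine List.Perm.eq_of_pairwise' (crossed_sorted f i) hs ?_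
  rw [List.perm_ext_iff_of_nodup ((crossed_sorted f i).imp fun h => h.ne) (hs.imp fun h => h.ne)]
  exact fun u => mem_crossed.trans (h u).symm

/-- A system of disjoint arcs that joins the ends of the strands in `l`. -/
structure IsSystem (l : List (Fin n)) (f : Fin (2 * n) → Fin (2 * n)) : Prop where
  involutive : Function.Involutive f
  noncrossing : IsNoncrossing f
  ne_self_iff : ∀ p, f p ≠ p ↔ ∃ i ∈ l, p = strandStart i ∨ p = strandEnd i

theorem isSystem_nil : IsSystem [] (id : Fin (2 * n) → Fin (2 * n)) where
  involutive _ := rfl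
  noncrossing u v _ _ := by unfold ArcsCross; simp
  ne_self_iff p := by simp

/-- The arcs of `f`, together with strand `i`. -/
abbrev addStrand (f : Fin (2 * n) → Fin (2 * n)) (i : Fin n) : Fin (2 * n) → Fin (2 * n) :=
  join f (strandStart i) (strandEnd i)

section AddStrand

variable {f : Fin (2 * n) → Fin (2 * n)} {i : Fin n}

theorem addStrand_end : addStrand f i (strandEnd i) = strandStart i := join_apply_right ..

theorem addStrand_start : addStrand f i (strandStart i) = strandEnd i := join_apply_left ..

theorem addStrand_of_ne {u : Fin (2 * n)} (h1 : u ≠ strandStart i) (h2 : u ≠ strandEnd i) :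
    addStrand f i u = f u := join_apply_of_ne h1 h2

theorem addStrand_of_isLeft {u : Fin (2 * n)} (h : IsLeft i u) : addStrand f i u = f u :=
  addStrand_of_ne h.ne_start h.ne_end

theorem distinctArcs_crossed (f : Fin (2 * n) → Fin (2 * n)) (i : Fin n) :
    DistinctArcs (strandEnd i) (addStrand f i) (crossed f i) := by
  refine ⟨(crossed_sorted f i).imp_of_mem fun {p q} hp hq hpq => ⟨hpq.ne, ?_⟩, fun p hp => ?_⟩
  · rw [addStrand_of_isLeft (mem_crossed.1 hp).1]
    exact fun h => (mem_crossed.1 hp).2 (h ▸ (mem_crossed.1 hq).1)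
  · obtain ⟨h1, h2⟩ := mem_crossed.1 hp
    rw [addStrand_end, addStrand_of_isLeft h1]
    exact ⟨h1.ne_end, h1.ne_start, fun h => h2 (h.symm ▸ h1)⟩

end AddStrand

namespace IsSystem

variable {l : List (Fin n)} {f : Fin (2 * n) → Fin (2 * n)} {i : Fin n}

theorem start_eq (h : IsSystem l f) (hi : i ∉ l) : f (strandStart i) = strandStart i := by
  by_contra hne
  obtain ⟨j, hj, h1 | h1⟩ := (h.ne_self_iff _).1 hne
  · exact hi (strandStart_injective h1 ▸ hj)
  · exact strandStart_ne_strandEnd _ _ h1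

theorem end_eq (h : IsSystem l f) (hi : i ∉ l) : f (strandEnd i) = strandEnd i := by
  by_contra hne
  obtain ⟨j, hj, h1 | h1⟩ := (h.ne_self_iff _).1 hne
  · exact strandStart_ne_strandEnd _ _ h1.symm
  · exact hi (strandEnd_injective h1 ▸ hj)

theorem apply_ne (h : IsSystem l f) (hi : i ∉ l) {u : Fin (2 * n)} (h1 : u ≠ strandStart i)
    (h2 : u ≠ strandEnd i) : f u ≠ strandStart i ∧ f u ≠ strandEnd i :=
  ⟨fun h' => h1 (by rw [← h.involutive u, h', h.start_eq hi]),
    fun h' => h2 (by rw [← h.involutive u, h', h.end_eq hi])⟩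

theorem addStrand_involutive (h : IsSystem l f) (hi : i ∉ l) :
    Function.Involutive (addStrand f i) := by
  intro u
  by_cases h1 : u = strandStart i
  · rw [h1, addStrand_start, addStrand_end]
  by_cases h2 : u = strandEnd i
  · rw [h2, addStrand_end, addStrand_start]
  obtain ⟨h3, h4⟩ := h.apply_ne hi h1 h2
  rw [addStrand_of_ne h1 h2, addStrand_of_ne h3 h4, h.involutive]

theorem addStrand_ne_self_iff (h : IsSystem l f) (p : Fin (2 * n)) :
    addStrand f i p ≠ p ↔ ∃ j ∈ l ++ [i], p = strandStart j ∨ p = strandEnd j := by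
  by_cases h1 : p = strandStart i
  · rw [h1, addStrand_start]
    exact iff_of_true (strandStart_ne_strandEnd _ _).symm ⟨i, by simp, Or.inl rfl⟩
  by_cases h2 : p = strandEnd i
  · rw [h2, addStrand_end]
    exact iff_of_true (strandStart_ne_strandEnd _ _) ⟨i, by simp, Or.inr rfl⟩
  rw [addStrand_of_ne h1 h2, h.ne_self_iff]
  constructor
  · rintro ⟨j, hj, h⟩
    exact ⟨j, by simp [hj], h⟩
  · rintro ⟨j, hj, h⟩
    rw [List.mem_append, List.mem_singleton] at hj
    rcases hj with hj | rfl
    · exact ⟨j, hj, h⟩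
    · exact absurd h (by simp [h1, h2])

theorem crossesOnly (h : IsSystem l f) (hi : i ∉ l) :
    CrossesOnly (strandEnd i) (addStrand f i) (crossed f i) := by
  have hval : ∀ {x y : Fin (2 * n)}, x ≠ y → (x : ℕ) ≠ y := fun h h' => h (Fin.ext h')
  have hlt : (strandStart i : ℕ) < strandEnd i := by
    have := i.2
    simp only [strandStart, strandEnd]; omega
  have hcr : ∀ u, u ≠ strandStart i → u ≠ strandEnd i →
      (ArcsCross (strandEnd i) (strandStart i) u (f u) ↔ ¬ (IsLeft i u ↔ IsLeft i (f u))) := by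
    intro u _ _
    unfold ArcsCross IsLeft
    rw [Fin.lt_def, Fin.lt_def, Fin.lt_def, Fin.lt_def]
    omega
  refine ⟨?_, fun p hp => ?_, fun u h1 h2 hu => ?_, ?_⟩
  · intro u v h1 h2 h3 h4 h5 h6
    rw [addStrand_end] at h2 h4
    rw [addStrand_of_ne h2 h1] at h6 ⊢
    rw [addStrand_of_ne h4 h3]
    exact h.noncrossing u v h5 h6
  · obtain ⟨h1, h2⟩ := mem_crossed.1 hp
    rw [addStrand_end, addStrand_of_isLeft h1, hcr p h1.ne_start h1.ne_end]
    tauto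
  · rw [addStrand_end] at h2 hu
    rw [addStrand_of_ne h2 h1] at hu ⊢
    rw [hcr u h2 h1] at hu
    rw [mem_crossed, mem_crossed, h.involutive]
    tauto
  -- Since the arcs of `f` are disjoint, the order of their left ends is the order in which the
  -- strand meets them.
  · refine (crossed_sorted f i).imp_of_mem fun {p q} hp hq hpq => ?_
    obtain ⟨h1, h2⟩ := mem_crossed.1 hp
    obtain ⟨h3, h4⟩ := mem_crossed.1 hq
    rw [addStrand_of_isLeft h1]
    have h5 := h.noncrossing p q hpq.ne fun h => h2 (h ▸ h3)
    have h6 := hval (h.apply_ne hi h1.ne_start h1.ne_end).1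
    have h7 := hval (h.apply_ne hi h1.ne_start h1.ne_end).2
    have h8 := hval (h.apply_ne hi h3.ne_start h3.ne_end).1
    have h9 := hval (h.apply_ne hi h3.ne_start h3.ne_end).2
    have h10 : (f p : ℕ) ≠ f q := hval fun h' => hpq.ne (h.involutive.injective h')
    have h11 : (q : ℕ) ≠ f p := hval fun h => h2 (h ▸ h3)
    unfold ArcsCross IsLeft at *
    simp only [Fin.lt_def] at *
    omega

end IsSystem

theorem chain_apply_eq_self_iff {Y : Type*} [DecidableEq Y] {b : Y} {F : Y → Y} {ps xs : List Y}
    {d : ℤ} (hF : Function.Involutive F) (hb : F b ≠ b) (hps : DistinctArcs b F ps)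
    (h : Choice F ps xs d) (u : Y) : chain b xs F u = u ↔ F u = u := by
  induction ps generalizing F xs d with
  | nil =>
    cases h
    rfl
  | cons p ps ih =>
    rcases h with _ | ⟨ε, _, h⟩
    obtain ⟨h1, h2, h3⟩ := hps.pick_ne hF ε
    rw [chain, ih (surger_involutive hF) (by rwa [Ne, surger_apply_eq_self_iff hb h3])
      (hps.surger hF ε) (h.congr fun q hq => (hps.surger_apply hF ε q hq).symm),
      surger_apply_eq_self_iff hb h3]

variable {l : List (Fin n)} {f g G : Fin (2 * n) → Fin (2 * n)} {i : Fin n} {t u : ℤ}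

theorem choice_addStrand_iff {xs : List (Fin (2 * n))} {d : ℤ} :
    Choice (addStrand f i) (crossed f i) xs d ↔ Choice f (crossed f i) xs d := by
  have : ∀ p ∈ crossed f i, addStrand f i p = f p :=
    fun p hp => addStrand_of_isLeft (mem_crossed.1 hp).1
  exact ⟨fun h => h.congr this, fun h => h.congr fun p hp => (this p hp).symm⟩

theorem mem_addOverstrand (h : IsSystem l f) (hi : i ∉ l) :
    (G, u) ∈ addOverstrand i (f, t) ↔ ∃ xs d, Choice f (crossed f i) xs d ∧ u = t + d ∧
      G = chain (strandEnd i) xs (addStrand f i) := by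
  rw [addOverstrand, mem_resolve (h.addStrand_involutive hi) (strandStart_ne_strandEnd i i)
    (distinctArcs_crossed f i)]
  simp only [choice_addStrand_iff]

theorem IsSystem.chain (h : IsSystem l f) (hi : i ∉ l) {xs : List (Fin (2 * n))} {d : ℤ}
    (hxs : Choice f (crossed f i) xs d) :
    IsSystem (l ++ [i]) (chain (strandEnd i) xs (addStrand f i)) := by
  have hF := h.addStrand_involutive hi
  have hxs' := choice_addStrand_iff.2 hxs
  refine ⟨chain_involutive hF, (h.crossesOnly hi).chain hF (distinctArcs_crossed f i) hxs', fun p => ?_⟩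
  rw [Ne, chain_apply_eq_self_iff hF _ (distinctArcs_crossed f i) hxs']
  · exact h.addStrand_ne_self_iff p
  · rw [addStrand_end]; exact strandStart_ne_strandEnd i i

theorem isSystem_of_mem_lay (hl : l.Nodup) (h : (f, t) ∈ lay l) : IsSystem l f := by
  induction l using List.reverseRecOn generalizing f t with
  | nil =>
    rw [lay, List.foldl_nil, List.mem_singleton, Prod.mk.injEq] at h
    rw [h.1]
    exact isSystem_nil
  | append_singleton l i ih =>
    rw [List.nodup_append] at hl
    have hi : i ∉ l := fun hi => hl.2.2 i hi i (by simp) rfl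
    obtain ⟨⟨g, s⟩, hg, hmem⟩ := mem_lay_append.1 h
    have hsys := ih hl.1 hg
    obtain ⟨xs, d, hxs, -, rfl⟩ := (mem_addOverstrand hsys hi).1 hmem
    exact hsys.chain hi hxs

/-- A resolution to which no move leads to one with a power of `A` that is larger by `2` (for
`ε = true`) or smaller by `2` (for `ε = false`). -/
def IsExtreme (ε : Bool) (L : List ((Fin (2 * n) → Fin (2 * n)) × ℤ))
    (f : Fin (2 * n) → Fin (2 * n)) (t : ℤ) : Prop :=
  (f, t) ∈ L ∧ ∀ g, (g, t + 2 * splitSign ε) ∈ L → ¬ ArcMove f g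

/-- The resolution of all crossings of strand `i` with the arcs of `f` in the same way. -/
def uniformResolution (ε : Bool) (f : Fin (2 * n) → Fin (2 * n)) (i : Fin n) :
    Fin (2 * n) → Fin (2 * n) :=
  chain (strandEnd i) ((crossed f i).map (pick f ε)) (addStrand f i)

/-- Any non-uniform choice on the top strand could be improved by one flip, with the arcs below
unchanged. -/
theorem IsExtreme.exists_eq_uniformResolution {ε : Bool} (hl : l.Nodup) (hi : i ∉ l)
    (h : IsExtreme ε (lay (l ++ [i])) G u) : ∃ f t, (f, t) ∈ lay l ∧
      u = t + (crossed f i).length * splitSign ε ∧ G = uniformResolution ε f i := by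
  obtain ⟨hG, hext⟩ := h
  obtain ⟨⟨f, t⟩, hf, hmem⟩ := mem_lay_append.1 hG
  have hsys := isSystem_of_mem_lay hl hf
  obtain ⟨xs, d, hxs, rfl, rfl⟩ := (mem_addOverstrand hsys hi).1 hmem
  refine ⟨f, t, hf, ?_⟩
  have hmap : (crossed f i).map (pick (addStrand f i) ε) = (crossed f i).map (pick f ε) :=
    List.map_congr_left fun p hp => by
      rw [pick, pick, addStrand_of_isLeft (mem_crossed.1 hp).1]
  rcases (choice_addStrand_iff.2 hxs).eq_uniform_or_exists ε (hsys.addStrand_involutive hi)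
    (by rw [addStrand_end]; exact strandStart_ne_strandEnd i i) (distinctArcs_crossed f i) with
    ⟨h1, h2⟩ | ⟨xs', h1, h2⟩
  · rw [h1, h2, hmap]
    exact ⟨rfl, rfl⟩
  · refine absurd h2 (hext _ (mem_lay_append.2 ⟨_, hf, (mem_addOverstrand hsys hi).2
      ⟨xs', _, choice_addStrand_iff.1 h1, ?_, rfl⟩⟩))
    ring

end MultiSkein

/-! ### Lifting a move through a strand that meets at most one arc. -/

/-- If `F` joins `b` to `c` and `G` arises from `F` by the move `p – q`, `r – s` to `p – r`,
`q – s`, then laying the arc `b – c` of `G` over the two new arcs and resolving in opposite ways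
gives another move of `F`. -/
theorem arcMove_surger_surger_of_move {Y : Type*} [DecidableEq Y] {F G : Y → Y} {b c p q r s : Y}
    (hF : Function.Involutive F) (hG : Function.Involutive G)
    (hFb : F b = c) (hGb : G b = c) (hFp : F p = q) (hFr : F r = s)
    (hGp : G p = r) (hGq : G q = s) (hFG : ∀ u, u ≠ p → u ≠ q → u ≠ r → u ≠ s → G u = F u)
    (hbc : b ≠ c) (hb : b ≠ p ∧ b ≠ q ∧ b ≠ r ∧ b ≠ s) (hc : c ≠ p ∧ c ≠ q ∧ c ≠ r ∧ c ≠ s)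
    (hpq : p ≠ q) (hpr : p ≠ r) (hps : p ≠ s) (hqs : q ≠ s) (hrs : r ≠ s) :
    ArcMove F (surger b s (surger b p G)) := by
  obtain ⟨hb1, hb2, hb3, hb4⟩ := hb
  obtain ⟨hc1, hc2, hc3, hc4⟩ := hc
  have hFc : F c = b := by rw [← hFb, hF]
  have hFs : F s = r := by rw [← hFr, hF]
  have hGc : G c = b := by rw [← hGb, hG]
  have hGr : G r = p := by rw [← hGp, hG]
  have hGs : G s = q := by rw [← hGq, hG]
  have h1c : surger b p G c = p := surger_apply_of_apply_eq_left hbc.symm hc1 hGc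
  have h1s : surger b p G s = q := by
    rw [surger_apply_of_ne hb4.symm hps.symm] <;> rw [hGs]
    exacts [hb2.symm, hpq.symm]
  have h1p : surger b p G p = c := by
    rw [surger_apply_right] <;> rw [hGb]
    exacts [hbc.symm, hc1]
  have h1q : surger b p G q = s := by
    rw [surger_apply_of_ne hb2.symm hpq.symm] <;> rw [hGq]
    exacts [hb4.symm, hps.symm]
  have h1r : surger b p G r = b := surger_apply_of_apply_eq_right hb3.symm hpr.symm hGr
  have h2c : surger b s (surger b p G) c = p := by
    rw [surger_apply_of_ne hbc.symm hc4] <;> rw [h1c]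
    exacts [hb1.symm, hps]
  have h2b : surger b s (surger b p G) b = q := by
    rw [surger_apply_left] <;> rw [h1s]
    exacts [hb2.symm, hqs]
  have h1 : ∀ u, u ≠ b → u ≠ c → u ≠ p → u ≠ q → u ≠ r → u ≠ s →
      surger b s (surger b p G) u = F u := by
    intro u ub uc up uq ur us
    have e := hFG u up uq ur us
    have hub : F u ≠ b := fun h => uc (by rw [← hFb, ← h, hF])
    have hup : F u ≠ p := fun h => uq (by rw [← hFp, ← h, hF])
    have hus : F u ≠ s := fun h => ur (by rw [← hFs, ← h, hF])
    have e1 : surger b p G u = F u := by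
      rw [surger_apply_of_ne ub up (by rwa [e]) (by rwa [e]), e]
    rw [surger_apply_of_ne ub us (by rwa [e1]) (by rwa [e1]), e1]
  -- The surgeries restore `r – s`; the net effect is to replace `c – b`, `p – q` by `c – p`, `b –
  -- q`.
  refine ⟨c, b, p, q, hFc, hFp, hc1.symm, hb1.symm, h2c, h2b, fun u h3 h4 h5 h6 => ?_⟩
  by_cases h7 : u = r
  · rw [h7, hFr]
    exact surger_apply_of_apply_eq_left hb3.symm hrs h1r
  by_cases h8 : u = s
  · have e1 : surger b p G b = r := by
      rw [surger_apply_left] <;> rw [hGp]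
      exacts [hb3.symm, hpr.symm]
    rw [h8, hFs, surger_apply_right] <;> rw [e1]
    exacts [hb3.symm, hrs]
  exact h1 u h4 h3 h5 h6 h7 h8

namespace MultiSkein

variable {n : ℕ} {l : List (Fin n)} {f g : Fin (2 * n) → Fin (2 * n)} {i : Fin n}

theorem arcMove_addStrand (hf : IsSystem l f) (hg : IsSystem l g) (hi : i ∉ l) (h : ArcMove f g) :
    ArcMove (addStrand f i) (addStrand g i) := by
  obtain ⟨p, q, r, s, hfp, hfr, hrp, hrq, hgp, hgq, hfg⟩ := h
  have hne : ∀ u, f u ≠ g u → u ≠ strandStart i ∧ u ≠ strandEnd i := by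
    refine fun u hu => ⟨?_, ?_⟩ <;> rintro rfl
    · exact hu (by rw [hf.start_eq hi, hg.start_eq hi])
    · exact hu (by rw [hf.end_eq hi, hg.end_eq hi])
  have hp := hne p (by rw [hfp, hgp]; exact hrq.symm)
  have hq := hf.apply_ne hi hp.1 hp.2
  have hr := hg.apply_ne hi hp.1 hp.2
  have hs := hg.apply_ne hi hq.1 hq.2
  rw [hfp] at hq hs
  rw [hgp] at hr
  rw [hgq] at hs
  refine ⟨p, q, r, s, ?_, ?_, hrp, hrq, ?_, ?_, fun u h1 h2 h3 h4 => ?_⟩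
  · rw [addStrand_of_ne hp.1 hp.2, hfp]
  · rw [addStrand_of_ne hr.1 hr.2, hfr]
  · rw [addStrand_of_ne hp.1 hp.2, hgp]
  · rw [addStrand_of_ne hq.1 hq.2, hgq]
  · by_cases h5 : u = strandStart i
    · rw [h5, addStrand_start, addStrand_start]
    by_cases h6 : u = strandEnd i
    · rw [h6, addStrand_end, addStrand_end]
    rw [addStrand_of_ne h5 h6, addStrand_of_ne h5 h6, hfg u h1 h2 h3 h4]

/-- The points of a move `p – q`, `r – s` to `p – r`, `q – s` between two systems of arcs. -/
structure MovePoints (f g : Fin (2 * n) → Fin (2 * n)) (p q r s : Fin (2 * n)) : Prop where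
  fp : f p = q
  fq : f q = p
  fr : f r = s
  fs : f s = r
  gp : g p = r
  gr : g r = p
  gq : g q = s
  gs : g s = q
  pq : p ≠ q
  pr : p ≠ r
  ps : p ≠ s
  qr : q ≠ r
  qs : q ≠ s
  rs : r ≠ s
  eq : ∀ u, u ≠ p → u ≠ q → u ≠ r → u ≠ s → g u = f u

namespace MovePoints

variable {p q r s : Fin (2 * n)}

theorem symm_left (h : MovePoints f g p q r s) : MovePoints f g q p s r :=
  ⟨h.fq, h.fp, h.fs, h.fr, h.gq, h.gs, h.gp, h.gr, h.pq.symm, h.qs, h.qr, h.ps, h.pr, h.rs.symm,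
    fun u h1 h2 h3 h4 => h.eq u h2 h1 h4 h3⟩

theorem symm_right (h : MovePoints f g p q r s) : MovePoints f g r s p q :=
  ⟨h.fr, h.fs, h.fp, h.fq, h.gr, h.gp, h.gs, h.gq, h.rs, h.pr.symm, h.qr.symm, h.ps.symm,
    h.qs.symm, h.pq, fun u h1 h2 h3 h4 => h.eq u h3 h4 h1 h2⟩

theorem arcMove (h : MovePoints f g p q r s) : ArcMove f g :=
  ⟨p, q, r, s, h.fp, h.fr, h.pr.symm, h.qr.symm, h.gp, h.gq, h.eq⟩

theorem of_involutive (hf : Function.Involutive f) (hg : Function.Involutive g)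
    (hfg : ∀ u, f u = u → g u = u) (h : ArcMove f g) : ∃ p q r s, MovePoints f g p q r s := by
  obtain ⟨p, q, r, s, hfp, hfr, hrp, hrq, hgp, hgq, heq⟩ := h
  have hpq : p ≠ q := by
    rintro rfl
    exact hrp (hgp.symm.trans (hfg _ hfp))
  have hrs : r ≠ s := by
    rintro rfl
    have := hfg _ hfr
    rw [← hgp, hg, hgp] at this
    exact hrp this.symm
  refine ⟨p, q, r, s, hfp, by rw [← hfp, hf], hfr, by rw [← hfr, hf], hgp, by rw [← hgp, hg],
    hgq, by rw [← hgq, hg], hpq, hrp.symm, ?_, hrq.symm, ?_, hrs, heq⟩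
  · rintro rfl
    exact hrq (by rw [← hfp, ← hfr, hf])
  · rintro rfl
    exact hrp (by rw [← hf r, hfr, ← hfp, hf])

end MovePoints

theorem IsSystem.apply_eq_self_imp (hf : IsSystem l f) (hg : IsSystem l g) (u : Fin (2 * n))
    (h : f u = u) : g u = u := by
  by_contra hne
  exact (hf.ne_self_iff u).2 ((hg.ne_self_iff u).1 hne) h

/-- A move of `f` lifts to a move of a uniform resolution of `f` and strand `i`. -/
def MoveLifts (ε : Bool) (f g : Fin (2 * n) → Fin (2 * n)) (i : Fin n) : Prop :=
  ∃ xs, Choice g (crossed g i) xs ((crossed f i).length * splitSign ε) ∧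
    ArcMove (uniformResolution ε f i) (chain (strandEnd i) xs (addStrand g i))

variable {p q r s : Fin (2 * n)} (ε : Bool)

/-- The strand meets none of the moved arcs, old or new, so that the same surgeries apply to both
systems. -/
theorem moveLifts_of_same_side (hf : IsSystem l f) (hg : IsSystem l g) (hi : i ∉ l)
    (h : MovePoints f g p q r s) (hpq : IsLeft i p ↔ IsLeft i q) (hrs : IsLeft i r ↔ IsLeft i s)
    (hpr : IsLeft i p ↔ IsLeft i r) : MoveLifts ε f g i := by
  have hcr : crossed g i = crossed f i := by
    refine crossed_eq (crossed_sorted f i) fun u => ?_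
    rw [mem_crossed]
    by_cases h1 : u = p
    · rw [h1, h.fp, h.gp]; tauto
    by_cases h2 : u = q
    · rw [h2, h.fq, h.gq]; tauto
    by_cases h3 : u = r
    · rw [h3, h.fr, h.gr]; tauto
    by_cases h4 : u = s
    · rw [h4, h.fs, h.gs]; tauto
    rw [h.eq u h1 h2 h3 h4]
  have hfg : ∀ u ∈ crossed f i, f u = g u := by
    intro u hu
    obtain ⟨h1, h2⟩ := mem_crossed.1 hu
    refine (h.eq u ?_ ?_ ?_ ?_).symm <;> rintro rfl
    · rw [h.fp] at h2; tauto
    · rw [h.fq] at h2; tauto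
    · rw [h.fr] at h2; tauto
    · rw [h.fs] at h2; tauto
  refine ⟨_, ?_, (arcMove_addStrand hf hg hi h.arcMove).chain _ _⟩
  rw [hcr]
  exact (Choice.uniform f ε _).congr hfg

theorem isLeft_ne {u v : Fin (2 * n)} (hu : IsLeft i u) (hv : ¬ IsLeft i v) : u ≠ v :=
  fun h => hv (h ▸ hu)

/-- The move pushes two arcs across the strand. Resolving the two new crossings in opposite ways
contributes nothing to the power and, by `arcMove_surger_surger_of_move`, leaves a move of the
overstrand with `p – q`. -/
theorem moveLifts_of_new_crossings (hf : IsSystem l f) (hg : IsSystem l g) (hi : i ∉ l)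
    (hk : (crossed f i).length ≤ 1) (h : MovePoints f g p q r s) (hp : IsLeft i p)
    (hq : IsLeft i q) (hr : ¬ IsLeft i r) (hs : ¬ IsLeft i s) (hpq : p < q) :
    MoveLifts ε f g i := by
  have hF := hf.addStrand_involutive hi
  have hG := hg.addStrand_involutive hi
  have hr' : r ≠ strandStart i ∧ r ≠ strandEnd i := h.gp ▸ hg.apply_ne hi hp.ne_start hp.ne_end
  have hs' : s ≠ strandStart i ∧ s ≠ strandEnd i := h.gq ▸ hg.apply_ne hi hq.ne_start hq.ne_end
  have hFp : addStrand f i p = q := (addStrand_of_isLeft hp).trans h.fp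
  have hFr : addStrand f i r = s := (addStrand_of_ne hr'.1 hr'.2).trans h.fr
  have hGp : addStrand g i p = r := (addStrand_of_isLeft hp).trans h.gp
  have hGq : addStrand g i q = s := (addStrand_of_isLeft hq).trans h.gq
  have hFG : ∀ u, u ≠ p → u ≠ q → u ≠ r → u ≠ s → addStrand g i u = addStrand f i u := by
    intro u h1 h2 h3 h4
    by_cases h5 : u = strandStart i
    · rw [h5, addStrand_start, addStrand_start]
    by_cases h6 : u = strandEnd i
    · rw [h6, addStrand_end, addStrand_end]
    rw [addStrand_of_ne h5 h6, addStrand_of_ne h5 h6, h.eq u h1 h2 h3 h4]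
  have hmove : ArcMove (addStrand f i)
      (surger (strandEnd i) s (surger (strandEnd i) p (addStrand g i))) :=
    arcMove_surger_surger_of_move hF hG addStrand_end addStrand_end hFp hFr hGp hGq hFG
      (strandStart_ne_strandEnd i i).symm ⟨hp.ne_end.symm, hq.ne_end.symm, hr'.2.symm, hs'.2.symm⟩
      ⟨hp.ne_start.symm, hq.ne_start.symm, hr'.1.symm, hs'.1.symm⟩ h.pq h.pr h.ps h.qs h.rs
  have hgcr : ∀ u, IsLeft i u ∧ ¬ IsLeft i (g u) ↔ u ∈ crossed f i ∨ u = p ∨ u = q := by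
    intro u
    rw [mem_crossed]
    by_cases h1 : u = p
    · rw [h1, h.gp]; tauto
    by_cases h2 : u = q
    · rw [h2, h.gq]; tauto
    by_cases h3 : u = r
    · rw [h3]; exact iff_of_false (by tauto) (by simp [hr, h.pr.symm, h.qr.symm])
    by_cases h4 : u = s
    · rw [h4]; exact iff_of_false (by tauto) (by simp [hs, h.ps.symm, h.qs.symm])
    rw [h.eq u h1 h2 h3 h4]
    tauto
  have hpick : pick g false q = s := h.gq
  have hpick' : pick g true p = p := rfl
  rcases hcf : crossed f i with _ | ⟨u, us⟩
  · have hcg : crossed g i = [p, q] := crossed_eq (by simpa using hpq) fun v => by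
      rw [hgcr, hcf]; simp
    -- An `A`-split at `p` and a `B`-split at `q`, whose picked end is `g q = s`.
    refine ⟨[p, s], ?_, ?_⟩
    · rw [hcg, hcf]
      have := Choice.cons (f := g) true p (.cons false q .nil)
      rw [hpick, hpick'] at this
      simpa [splitSign] using this
    · rw [uniformResolution, hcf]
      exact hmove
  · obtain rfl : us = [] := by
      rw [hcf] at hk
      simpa using hk
    have hu : u ∈ crossed f i := by simp [hcf]
    obtain ⟨hu1, hu2⟩ := mem_crossed.1 hu
    have hup : u ≠ p := by rintro rfl; rw [h.fp] at hu2; exact hu2 hq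
    have huq : u ≠ q := by rintro rfl; rw [h.fq] at hu2; exact hu2 hp
    have hur : u ≠ r := by rintro rfl; exact hr hu1
    have hus : u ≠ s := by rintro rfl; exact hs hu1
    have hgu := h.eq u hup huq hur hus
    have hpicku : pick g ε u = pick f ε u := by rw [pick, pick, hgu]
    set x := pick f ε u with hx
    -- An arc from `u` to the other side would cross `p – q`. Hence the new crossings at `p` and `q`
    -- are consecutive along the strand.
    have hnb : ¬ (p < u ∧ u < q) := by
      rintro ⟨h1, h2⟩
      refine hf.noncrossing p u hup.symm (by rw [h.fp]; exact huq.symm) ?_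
      rw [h.fp]
      unfold ArcsCross
      unfold IsLeft at hu2 hp hq
      simp only [Fin.lt_def] at *
      omega
    have hd : ((([u] : List (Fin (2 * n))).length : ℕ) : ℤ) * splitSign ε = splitSign ε := by simp
    rcases lt_or_gt_of_ne hup with hlt | hlt
    · have hcg : crossed g i = [u, p, q] :=
        crossed_eq (by simp [hlt, hpq, hlt.trans hpq]) fun v => by
          rw [hgcr, hcf]; simp
      refine ⟨[x, p, s], ?_, ?_⟩
      · rw [hcg, hcf, hd]
        have := Choice.cons (f := g) ε u (.cons true p (.cons false q .nil))
        rw [hpick, hpick', hpicku] at this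
        simpa [splitSign] using this
      · rw [uniformResolution, hcf]
        have hFu : addStrand f i u = f u := addStrand_of_isLeft hu1
        have hGu : addStrand g i u = f u := (addStrand_of_isLeft hu1).trans hgu
        have hfu := hf.apply_ne hi hu1.ne_start hu1.ne_end
        have hfup : f u ≠ p := fun h' => hu2 (h' ▸ hp)
        have hfuq : f u ≠ q := fun h' => hu2 (h' ▸ hq)
        have hfur : f u ≠ r := fun h' => hus (by rw [← hf.involutive u, h', h.fr])
        have hfus : f u ≠ s := fun h' => hur (by rw [← hf.involutive u, h', h.fs])
        have hFx : addStrand f i x = addStrand g i x ∧ addStrand f i x ≠ strandEnd i ∧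
            addStrand f i x ≠ x ∧ x ≠ strandEnd i ∧
            (addStrand f i x ≠ p ∧ addStrand f i x ≠ q ∧ addStrand f i x ≠ r ∧
              addStrand f i x ≠ s) ∧ x ≠ p ∧ x ≠ q ∧ x ≠ r ∧ x ≠ s := by
          have hfuu : f u ≠ u := fun h' => hu2 (h'.symm ▸ hu1)
          rcases pick_eq_or f ε u with h' | h' <;> rw [hx, h']
          · rw [hFu, hGu]
            exact ⟨rfl, hfu.2, hfuu, hu1.ne_end, ⟨hfup, hfuq, hfur, hfus⟩, hup, huq, hur, hus⟩
          · have e1 : addStrand f i (f u) = u := by rw [← hFu, hF]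
            have e2 : addStrand g i (f u) = u := by rw [← hGu, hG]
            rw [e1, e2]
            exact ⟨rfl, hu1.ne_end, hfuu.symm, hfu.2, ⟨hup, huq, hur, hus⟩, hfup, hfuq, hfur, hfus⟩
        obtain ⟨e1, e2, e3, e4, e5, x1, x2, x3, x4⟩ := hFx
        have hsne : ∀ {H : Fin (2 * n) → Fin (2 * n)} {v w : Fin (2 * n)}, v ≠ strandEnd i →
            v ≠ x → H v = w → w ≠ strandEnd i → w ≠ x → surger (strandEnd i) x H v = w := by
          rintro H v _ h1 h2 rfl h3 h4
          exact surger_apply_of_ne h1 h2 h3 h4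
        -- When `u` comes first, its surgery is done in both systems; what is left of the overstrand
        -- then starts at `addStrand f i x`.
        refine arcMove_surger_surger_of_move (F := surger (strandEnd i) x (addStrand f i))
          (G := surger (strandEnd i) x (addStrand g i)) (c := addStrand f i x) (p := p) (q := q)
          (r := r) (s := s)
          (surger_involutive hF) (surger_involutive hG) (surger_apply_left e2 e3)
          ((surger_apply_left (by rwa [← e1]) (by rwa [← e1])).trans e1.symm)
          (hsne hp.ne_end x1.symm hFp hq.ne_end x2.symm)
          (hsne hr'.2 x3.symm hFr hs'.2 x4.symm)
          (hsne hp.ne_end x1.symm hGp hr'.2 x3.symm)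
          (hsne hq.ne_end x2.symm hGq hs'.2 x4.symm) ?_ e2.symm
          ⟨hp.ne_end.symm, hq.ne_end.symm, hr'.2.symm, hs'.2.symm⟩ e5
          h.pq h.pr h.ps h.qs h.rs
        intro v h1 h2 h3 h4
        have hsw : ∀ w, w ≠ strandEnd i → w ≠ x → ∀ v, v ≠ w →
            Equiv.swap (strandEnd i) x v ≠ w := by
          intro w hw1 hw2 v hv h'
          rw [Equiv.swap_apply_eq_iff, Equiv.swap_apply_of_ne_of_ne hw1 hw2] at h'
          exact hv h'
        rw [surger, surger, hFG _ (hsw p hp.ne_end x1.symm v h1) (hsw q hq.ne_end x2.symm v h2)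
          (hsw r hr'.2 x3.symm v h3) (hsw s hs'.2 x4.symm v h4)]
    · have hlt' : q < u := lt_of_le_of_ne (not_lt.1 fun h => hnb ⟨hlt, h⟩) huq.symm
      have hcg : crossed g i = [p, q, u] :=
        crossed_eq (by simp [hlt', hpq, hpq.trans hlt']) fun v => by
          rw [hgcr, hcf]
          simp only [List.mem_cons, List.not_mem_nil, or_false]
          tauto
      refine ⟨[p, s, x], ?_, ?_⟩
      · rw [hcg, hcf, hd]
        have := Choice.cons (f := g) true p (.cons false q (.cons ε u .nil))
        rw [hpick, hpick', hpicku] at this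
        simpa [splitSign] using this
      · rw [uniformResolution, hcf]
        exact hmove.surger _ _

/-- Exactly one of the new arcs meets the strand. It shares an end with `p – q`, and surgery there
is conjugation by the same transposition in both systems, if need be after changing to the other end
of the overstrand. -/
theorem moveLifts_of_crossing (hf : IsSystem l f) (hg : IsSystem l g) (hi : i ∉ l)
    (hk : (crossed f i).length ≤ 1) (h : MovePoints f g p q r s) (hp : IsLeft i p)
    (hq : ¬ IsLeft i q) (hrs : IsLeft i r ↔ IsLeft i s) : MoveLifts ε f g i := by
  have hF := hf.addStrand_involutive hi
  have hG := hg.addStrand_involutive hi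
  have hmove := arcMove_addStrand hf hg hi h.arcMove
  have hpf : p ∈ crossed f i := mem_crossed.2 ⟨hp, by rwa [h.fp]⟩
  have hcf : crossed f i = [p] := by
    rcases hc : crossed f i with _ | ⟨v, vs⟩
    · simp [hc] at hpf
    · rw [hc] at hk hpf
      obtain rfl : vs = [] := by simpa using hk
      rw [List.mem_singleton.1 hpf]
  have hfcr : ∀ u, u ≠ p → ¬ (IsLeft i u ∧ ¬ IsLeft i (f u)) := by
    intro u hu h'
    rw [← mem_crossed, hcf, List.mem_singleton] at h'
    exact hu h'
  have hd : ((([p] : List (Fin (2 * n))).length : ℕ) : ℤ) * splitSign ε = 0 + splitSign ε := by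
    simp
  have hq' : q ≠ strandStart i ∧ q ≠ strandEnd i := h.fp ▸ hf.apply_ne hi hp.ne_start hp.ne_end
  have hr' : r ≠ strandStart i ∧ r ≠ strandEnd i := h.gp ▸ hg.apply_ne hi hp.ne_start hp.ne_end
  have hs' : s ≠ strandStart i ∧ s ≠ strandEnd i := h.gq ▸ hg.apply_ne hi hq'.1 hq'.2
  have hFp : addStrand f i p = q := (addStrand_of_isLeft hp).trans h.fp
  have hswap : ∀ {H : Fin (2 * n) → Fin (2 * n)} {x y : Fin (2 * n)}, Function.Involutive H →
      H (strandEnd i) = strandStart i → H x = y → x ≠ y → x ≠ strandEnd i → x ≠ strandStart i →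
      surger (strandEnd i) x H = surger (strandStart i) y H := by
    rintro H x _ hH he rfl hxy h1 h2
    rw [surger_eq_surger_apply hH _ hxy.symm h1 (by rwa [he]), he]
    rw [he]; exact strandStart_ne_strandEnd i i
  by_cases hr : IsLeft i r
  · have hs := hrs.1 hr
    have hcg : crossed g i = [s] := crossed_eq (by simp) fun u => by
      rw [List.mem_singleton]
      by_cases h1 : u = p
      · rw [h1, h.gp]; simp [hr, h.ps]
      by_cases h2 : u = q
      · rw [h2]; simp [hq, h.qs]
      by_cases h3 : u = r
      · rw [h3, h.gr]; simp [hp, h.rs]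
      by_cases h4 : u = s
      · rw [h4, h.gs]; simp [hs, hq]
      rw [h.eq u h1 h2 h3 h4]
      simpa [h4] using hfcr u h1
    have hGs : addStrand g i s = q := (addStrand_of_isLeft hs).trans h.gs
    refine ⟨[pick g ε s], ?_, ?_⟩
    · rw [hcg, hcf, hd]
      exact .cons ε s .nil
    · rw [uniformResolution, hcf]
      cases ε
      · simp only [List.map, pick, cond_false, h.fp, h.gs]
        exact hmove.chain _ _
      · simp only [List.map, pick, cond_true, chain]
        rw [hswap hF addStrand_end hFp h.pq hp.ne_end hp.ne_start,
          hswap hG addStrand_end hGs h.qs.symm hs'.2 hs'.1]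
        exact hmove.surger _ _
  · have hs := mt hrs.2 hr
    have hcg : crossed g i = [p] := crossed_eq (by simp) fun u => by
      rw [List.mem_singleton]
      by_cases h1 : u = p
      · rw [h1, h.gp]; simp [hr, hp]
      by_cases h2 : u = q
      · rw [h2]; simp [hq, h.pq.symm]
      by_cases h3 : u = r
      · rw [h3]; simp [hr, h.pr.symm]
      by_cases h4 : u = s
      · rw [h4]; simp [hs, h.ps.symm]
      rw [h.eq u h1 h2 h3 h4]
      simpa [h1] using hfcr u h1
    have hFq : addStrand f i q = p := (addStrand_of_ne hq'.1 hq'.2).trans h.fq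
    have hGr : addStrand g i r = p := (addStrand_of_ne hr'.1 hr'.2).trans h.gr
    refine ⟨[pick g ε p], ?_, ?_⟩
    · rw [hcg, hcf, hd]
      exact .cons ε p .nil
    · rw [uniformResolution, hcf]
      cases ε
      · simp only [List.map, pick, cond_false, h.fp, h.gp, chain]
        rw [hswap hF addStrand_end hFq h.pq.symm hq'.2 hq'.1,
          hswap hG addStrand_end hGr h.pr.symm hr'.2 hr'.1]
        exact hmove.surger _ _
      · simp only [List.map, pick, cond_true]
        exact hmove.chain _ _

/-- The cases are the positions of the four points of the move relative to the strand. The power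
contributed by the strand is kept, so that the difference of 2 between `f` and `g` survives. -/
theorem moveLifts (hf : IsSystem l f) (hg : IsSystem l g) (hi : i ∉ l)
    (hk : (crossed f i).length ≤ 1) (h : ArcMove f g) : MoveLifts ε f g i := by
  obtain ⟨p, q, r, s, h⟩ :=
    MovePoints.of_involutive hf.involutive hg.involutive (hf.apply_eq_self_imp hg) h
  -- With at most one crossing, at most one of the old arcs `p – q`, `r – s` meets the strand.
  wlog hrs : IsLeft i r ↔ IsLeft i s generalizing p q r s
  · refine this r s p q h.symm_right ?_
    by_contra hpq
    have hmem : ∀ {x y}, f x = y → f y = x → ¬ (IsLeft i x ↔ IsLeft i y) →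
        x ∈ crossed f i ∨ y ∈ crossed f i := by
      intro x y h1 h2 h3
      rw [mem_crossed, mem_crossed, h1, h2]
      tauto
    have huniq : ∀ {x y}, x ∈ crossed f i → y ∈ crossed f i → x = y := by
      intro x y hx hy
      rcases hc : crossed f i with _ | ⟨v, vs⟩
      · simp [hc] at hx
      · rw [hc] at hk hx hy
        obtain rfl : vs = [] := by simpa using hk
        rw [List.mem_singleton.1 hx, List.mem_singleton.1 hy]
    rcases hmem h.fp h.fq hpq with h1 | h1 <;> rcases hmem h.fr h.fs hrs with h2 | h2
    · exact h.pr (huniq h1 h2)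
    · exact h.ps (huniq h1 h2)
    · exact h.qr (huniq h1 h2)
    · exact h.qs (huniq h1 h2)
  by_cases hpq : IsLeft i p ↔ IsLeft i q
  · by_cases hpr : IsLeft i p ↔ IsLeft i r
    · exact moveLifts_of_same_side ε hf hg hi h hpq hrs hpr
    · by_cases hp : IsLeft i p
      · have hq := hpq.1 hp
        have hr : ¬ IsLeft i r := by tauto
        have hs : ¬ IsLeft i s := by tauto
        rcases lt_or_gt_of_ne h.pq with hlt | hlt
        · exact moveLifts_of_new_crossings ε hf hg hi hk h hp hq hr hs hlt
        · exact moveLifts_of_new_crossings ε hf hg hi hk h.symm_left hq hp hs hr hlt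
      · have hq : ¬ IsLeft i q := by tauto
        have hr : IsLeft i r := by tauto
        have hs : IsLeft i s := by tauto
        rcases lt_or_gt_of_ne h.rs with hlt | hlt
        · exact moveLifts_of_new_crossings ε hf hg hi hk h.symm_right hr hs hp hq hlt
        · exact moveLifts_of_new_crossings ε hf hg hi hk h.symm_right.symm_left hs hr hq hp hlt
  · by_cases hp : IsLeft i p
    · exact moveLifts_of_crossing ε hf hg hi hk h hp (by tauto) hrs
    · exact moveLifts_of_crossing ε hf hg hi hk h.symm_left (by tauto) hp hrs.symm

/-- If strand `i` crosses at most one arc of `f`, then a uniform resolution can be extreme only if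
`f` is. -/
theorem IsExtreme.of_uniformResolution {ε : Bool} {t : ℤ} (hl : l.Nodup) (hi : i ∉ l)
    (hf : (f, t) ∈ lay l) (hk : (crossed f i).length ≤ 1)
    (h : IsExtreme ε (lay (l ++ [i])) (uniformResolution ε f i)
      (t + (crossed f i).length * splitSign ε)) : IsExtreme ε (lay l) f t := by
  refine ⟨hf, fun g hg hmove => ?_⟩
  have hsys := isSystem_of_mem_lay hl hf
  have hsys' := isSystem_of_mem_lay hl hg
  obtain ⟨xs, hxs, hmv⟩ := moveLifts ε hsys hsys' hi hk hmove
  refine h.2 _ (mem_lay_append.2 ⟨_, hg, (mem_addOverstrand hsys' hi).2 ⟨xs, _, hxs, ?_, rfl⟩⟩) hmv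
  ring

end MultiSkein

/-! ### The shape of uniform resolutions. -/

theorem chain_apply_of_notMem {Y : Type*} [DecidableEq Y] {b u : Y} {xs : List Y} {F : Y → Y}
    (hu : u ≠ b) (hFu : F u ≠ b) (h1 : u ∉ xs) (h2 : F u ∉ xs) : chain b xs F u = F u := by
  induction xs generalizing F with
  | nil => rfl
  | cons x xs ih =>
    rw [List.mem_cons, not_or] at h1 h2
    have e : surger b x F u = F u := surger_apply_of_ne hu h1.1 hFu h2.1
    rw [chain, ih (by rwa [e]) h1.2 (by rw [e]; exact h2.2), e]

namespace MultiSkein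

variable {n : ℕ} {l : List (Fin n)} {f g S T : Fin (2 * n) → Fin (2 * n)} {i : Fin n}

theorem pick_crossed (hf : IsSystem l f) (hi : i ∉ l) (ε : Bool) :
    ((crossed f i).map (pick f ε)).Nodup ∧ ∀ x ∈ (crossed f i).map (pick f ε),
      (IsLeft i x ↔ ε = true) ∧ (IsLeft i (f x) ↔ ε = false) ∧
      (x ≠ strandStart i ∧ x ≠ strandEnd i) ∧ f x ≠ strandStart i ∧ f x ≠ strandEnd i := by
  constructor
  · refine List.Nodup.map_on ?_ ((crossed_sorted f i).imp fun h => h.ne)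
    intro p _ q _ hpq
    cases ε
    · exact hf.involutive.injective hpq
    · exact hpq
  · intro x hx
    obtain ⟨p, hp, rfl⟩ := List.mem_map.1 hx
    obtain ⟨h1, h2⟩ := mem_crossed.1 hp
    have h3 := hf.apply_ne hi h1.ne_start h1.ne_end
    cases ε
    · simp only [pick, cond_false, hf.involutive p]
      exact ⟨by simpa using h2, by simpa using h1, h3, h1.ne_start, h1.ne_end⟩
    · simp only [pick, cond_true]
      exact ⟨by simpa using h1, by simpa using h2, ⟨h1.ne_start, h1.ne_end⟩, h3⟩

theorem addStrand_inj (hf : IsSystem l f) (hg : IsSystem l g) (hi : i ∉ l)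
    (h : addStrand f i = addStrand g i) : f = g := by
  funext u
  by_cases h1 : u = strandStart i
  · rw [h1, hf.start_eq hi, hg.start_eq hi]
  by_cases h2 : u = strandEnd i
  · rw [h2, hf.end_eq hi, hg.end_eq hi]
  have := congrFun h u
  rwa [addStrand_of_ne h1 h2, addStrand_of_ne h1 h2] at this

theorem exists_uniformResolution_start (hf : IsSystem l f) (hi : i ∉ l) (ε : Bool)
    (h : crossed f i ≠ []) : ∃ x ∈ (crossed f i).map (pick f ε),
      uniformResolution ε f i (strandStart i) = x := by
  obtain ⟨hnd, hxs⟩ := pick_crossed hf hi ε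
  rw [uniformResolution]
  rcases hm : (crossed f i).map (pick f ε) with _ | ⟨x, xs⟩
  · exact absurd (List.map_eq_nil_iff.1 hm) h
  refine ⟨x, by simp, ?_⟩
  rw [hm] at hnd hxs
  obtain ⟨-, -, ⟨h1, h2⟩, -⟩ := hxs x (by simp)
  have e : surger (strandEnd i) x (addStrand f i) (strandStart i) = x :=
    surger_apply_of_apply_eq_left (strandStart_ne_strandEnd i i) h1.symm addStrand_start
  rw [chain, chain_apply_of_notMem (strandStart_ne_strandEnd i i) (by rwa [e]), e]
  · exact fun hmem => (hxs _ (List.mem_cons_of_mem _ hmem)).2.2.1.1 rfl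
  · rw [e]
    exact (List.nodup_cons.1 hnd).1

theorem exists_uniformResolution_end (hf : IsSystem l f) (hi : i ∉ l) (ε : Bool)
    (h : crossed f i ≠ []) : ∃ x ∈ (crossed f i).map (pick f ε),
      uniformResolution ε f i (strandEnd i) = f x := by
  obtain ⟨hnd, hxs⟩ := pick_crossed hf hi ε
  rw [uniformResolution]
  rcases List.eq_nil_or_concat ((crossed f i).map (pick f ε)) with hm | ⟨xs, x, hm⟩
  · exact absurd (List.map_eq_nil_iff.1 hm) h
  rw [List.concat_eq_append] at hm
  rw [hm] at hnd hxs ⊢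
  refine ⟨x, by simp, ?_⟩
  obtain ⟨h1, h2, ⟨h3, h4⟩, h5, h6⟩ := hxs x (by simp)
  have hFx : addStrand f i x = f x := addStrand_of_ne h3 h4
  have hne : f x ≠ x := by
    intro h; rw [h, h1] at h2; cases ε <;> simp at h2
  have e : chain (strandEnd i) xs (addStrand f i) x = f x := by
    rw [chain_apply_of_notMem h4 (by rwa [hFx]), hFx]
    · intro hmem
      rw [List.nodup_append] at hnd
      exact hnd.2.2 x hmem x (by simp) rfl
    · rw [hFx]
      intro hmem
      have := (hxs (f x) (by simp [hmem])).1
      rw [h2] at this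
      cases ε <;> simp at this
  rw [chain_append, chain, chain, surger_apply_left (by rwa [e]) (by rwa [e]), e]

/-- Only the first surgery affects the start of the strand, joining it to the picked end of the
first arc. These ends lie on the left for `A` and on the right for `B`; at the end of the strand it
is the reverse. -/
theorem uniformResolution_start (hf : IsSystem l f) (hi : i ∉ l) (ε : Bool)
    (h : crossed f i ≠ []) : (IsLeft i (uniformResolution ε f i (strandStart i)) ↔ ε = true) ∧
      uniformResolution ε f i (strandStart i) ≠ strandEnd i := by
  obtain ⟨x, hx, e⟩ := exists_uniformResolution_start hf hi ε h
  obtain ⟨h1, -, h3, -⟩ := (pick_crossed hf hi ε).2 x hx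
  rw [e]
  exact ⟨h1, h3.2⟩

theorem uniformResolution_end (hf : IsSystem l f) (hi : i ∉ l) (ε : Bool)
    (h : crossed f i ≠ []) : (IsLeft i (uniformResolution ε f i (strandEnd i)) ↔ ε = false) ∧
      uniformResolution ε f i (strandEnd i) ≠ strandStart i := by
  obtain ⟨x, hx, e⟩ := exists_uniformResolution_end hf hi ε h
  obtain ⟨-, h2, -, h4⟩ := (pick_crossed hf hi ε).2 x hx
  rw [e]
  exact ⟨h2, h4.1⟩

/-- The piece of the strand between its first two crossings joins the unpicked end of one arc to the
picked end of the next, which lie on different sides. -/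
theorem exists_crossing_of_uniformResolution (hf : IsSystem l f) (hi : i ∉ l) (ε : Bool)
    (h : 2 ≤ (crossed f i).length) : ∃ u, IsLeft i u ∧
      ¬ IsLeft i (uniformResolution ε f i u) ∧
      uniformResolution ε f i u ≠ strandStart i ∧ uniformResolution ε f i u ≠ strandEnd i := by
  obtain ⟨hnd, hxs⟩ := pick_crossed hf hi ε
  have hlen : 2 ≤ ((crossed f i).map (pick f ε)).length := by simpa using h
  have hinv : Function.Involutive (uniformResolution ε f i) :=
    chain_involutive (hf.addStrand_involutive hi)
  suffices hS : ∃ x y, (IsLeft i x ↔ ε = true) ∧ (IsLeft i y ↔ ε = false) ∧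
      (x ≠ strandStart i ∧ x ≠ strandEnd i) ∧ (y ≠ strandStart i ∧ y ≠ strandEnd i) ∧
      uniformResolution ε f i x = y by
    obtain ⟨x, y, h1, h2, h3, h4, h5⟩ := hS
    have h6 : uniformResolution ε f i y = x := by rw [← h5, hinv]
    cases ε
    · exact ⟨y, by simpa using h2, by rw [h6]; simpa using h1, by rw [h6]; exact h3.1,
        by rw [h6]; exact h3.2⟩
    · exact ⟨x, by simpa using h1, by rw [h5]; simpa using h2, by rw [h5]; exact h4.1,
        by rw [h5]; exact h4.2⟩
  rw [uniformResolution]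
  rcases hm : (crossed f i).map (pick f ε) with _ | ⟨x, _ | ⟨y, xs⟩⟩
  · simp [hm] at hlen
  · simp [hm] at hlen
  rw [hm] at hnd hxs
  obtain ⟨h1, h2, h3, h4⟩ := hxs x (by simp)
  obtain ⟨h5, h6, h7, h8⟩ := hxs y (by simp)
  have hFx : addStrand f i x = f x := addStrand_of_ne h3.1 h3.2
  have hside : ∀ z ∈ x :: y :: xs, f x ≠ z := by
    rintro z hz rfl
    have := (hxs _ hz).1
    rw [h2] at this
    cases ε <;> simp at this
  have e1 : surger (strandEnd i) x (addStrand f i) (strandEnd i) = f x := by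
    rw [surger_apply_left] <;> rw [hFx]
    exacts [h4.2, hside x (by simp)]
  have e2 : surger (strandEnd i) y (surger (strandEnd i) x (addStrand f i)) y = f x := by
    rw [surger_apply_right] <;> rw [e1]
    exacts [h4.2, hside y (by simp)]
  refine ⟨y, f x, h5, h2, h7, h4, ?_⟩
  rw [chain, chain, chain_apply_of_notMem h7.2 (by rw [e2]; exact h4.2), e2]
  · exact (List.nodup_cons.1 (List.nodup_cons.1 hnd).2).1
  · rw [e2]
    exact fun hmem => hside _ (by simp [hmem]) rfl

/-- A strand without crossings is not adjacent to a system of arcs whose arcs from the ends of the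
strand lead to different sides. -/
theorem not_arcMove_addStrand (hi : i ∉ l) (hf : IsSystem l f) (hc : crossed f i = [])
    (hT : IsSystem (l ++ [i]) T)
    (hside : ¬ (IsLeft i (T (strandStart i)) ↔ IsLeft i (T (strandEnd i))))
    (hend : T (strandStart i) ≠ strandEnd i) : ¬ ArcMove (addStrand f i) T := by
  intro h
  have hF := hf.addStrand_involutive hi
  obtain ⟨p, q, r, s, h⟩ := MovePoints.of_involutive hF hT.involutive (fun u hu => by
    by_contra hne
    exact (hf.addStrand_ne_self_iff u).2 ((hT.ne_self_iff u).1 hne) hu) h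
  obtain ⟨q, r, s, h⟩ : ∃ q r s, MovePoints (addStrand f i) T (strandStart i) q r s := by
    by_cases h1 : strandStart i = p
    · exact ⟨_, _, _, h1 ▸ h⟩
    by_cases h2 : strandStart i = q
    · exact ⟨_, _, _, h2 ▸ h.symm_left⟩
    by_cases h3 : strandStart i = r
    · exact ⟨_, _, _, h3 ▸ h.symm_right⟩
    by_cases h4 : strandStart i = s
    · exact ⟨_, _, _, h4 ▸ h.symm_right.symm_left⟩
    exact absurd (by rw [h.eq _ h1 h2 h3 h4, addStrand_start]) hend
  -- The move must replace the strand itself together with an arc `r – s` of `f`. That arc does not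
  -- meet the strand, and so both ends would be joined to the same side.
  obtain rfl : strandEnd i = q := by rw [← addStrand_start, h.fp]
  rw [h.gp, h.gq] at hside
  have hr := h.fr
  rw [addStrand_of_ne h.pr.symm h.qr.symm] at hr
  have hs := h.fs
  rw [addStrand_of_ne h.ps.symm h.qs.symm] at hs
  have h1 : r ∉ crossed f i := by simp [hc]
  have h2 : s ∉ crossed f i := by simp [hc]
  rw [mem_crossed, hr] at h1
  rw [mem_crossed, hs] at h2
  tauto

/-- If two systems of arcs, obtained from crossings of strand `i` resolved in opposite ways, differ
by a move, then there is only one crossing. -/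
theorem eq_of_arcMove_uniformResolution (hf : IsSystem l f) (hg : IsSystem l g) (hi : i ∉ l)
    (hcf : crossed f i ≠ []) (hcg : crossed g i ≠ [])
    (hS : IsSystem (l ++ [i]) (uniformResolution true f i))
    (hT : IsSystem (l ++ [i]) (uniformResolution false g i))
    (h : ArcMove (uniformResolution true f i) (uniformResolution false g i)) :
    f = g ∧ (crossed f i).length ≤ 1 ∧ (crossed g i).length ≤ 1 := by
  have hSa := uniformResolution_start hf hi true hcf
  have hSb := uniformResolution_end hf hi true hcf
  have hTa := uniformResolution_start hg hi false hcg
  have hTb := uniformResolution_end hg hi false hcg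
  have hS2 := exists_crossing_of_uniformResolution hf hi true
  have hT2 := exists_crossing_of_uniformResolution hg hi false
  have hSx := exists_uniformResolution_start hf hi true hcf
  have hTx := exists_uniformResolution_start hg hi false hcg
  have hSdef : uniformResolution true f i =
    chain (strandEnd i) ((crossed f i).map (pick f true)) (addStrand f i) := rfl
  have hTdef : uniformResolution false g i =
    chain (strandEnd i) ((crossed g i).map (pick g false)) (addStrand g i) := rfl
  set S := uniformResolution true f i
  set T := uniformResolution false g i
  simp only [iff_true, Bool.true_eq_false, iff_false, Bool.false_eq_true] at hSa hSb hTa hTb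
  obtain ⟨p, q, r, s, h⟩ := MovePoints.of_involutive hS.involutive hT.involutive
    (hS.apply_eq_self_imp hT) h
  -- Both ends of the strand change sides between `S` and `T`, so both belong to the move.
  obtain ⟨q, r, s, h⟩ : ∃ q r s, MovePoints S T (strandStart i) q r s := by
    by_cases h1 : strandStart i = p
    · exact ⟨_, _, _, h1 ▸ h⟩
    by_cases h2 : strandStart i = q
    · exact ⟨_, _, _, h2 ▸ h.symm_left⟩
    by_cases h3 : strandStart i = r
    · exact ⟨_, _, _, h3 ▸ h.symm_right⟩
    by_cases h4 : strandStart i = s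
    · exact ⟨_, _, _, h4 ▸ h.symm_right.symm_left⟩
    exact absurd hSa.1 (by rw [← h.eq _ h1 h2 h3 h4]; exact hTa.1)
  have hq : IsLeft i q := h.fp ▸ hSa.1
  have hr : ¬ IsLeft i r := h.gp ▸ hTa.1
  have hrb : r ≠ strandEnd i := h.gp ▸ hTa.2
  obtain rfl : strandEnd i = s := by
    by_contra hne
    refine hSb.1 ?_
    rw [← h.eq _ (strandStart_ne_strandEnd i i).symm hq.ne_end.symm hrb.symm hne]
    exact hTb.1
  -- An unchanged arc from `u` across the strand must avoid `strandStart i – q` in `S` and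
  -- `strandEnd i – q` in `T`, forcing `u` to lie both after and before `q`. With two crossings such
  -- an arc would exist.
  have hnone : ∀ u, IsLeft i u → ¬ IsLeft i (S u) → S u ≠ strandStart i → S u ≠ strandEnd i →
      T u = S u → False := by
    intro u h1 h2 h3 h4 h5
    have huq : q ≠ u := by
      rintro rfl
      exact h3 h.fq
    have hval : ∀ {x y : Fin (2 * n)}, x ≠ y → (x : ℕ) ≠ y := fun h h' => h (Fin.ext h')
    have c1 := hS.noncrossing (strandStart i) u h1.ne_start.symm (by rwa [h.fp])
    have c2 := hT.noncrossing (strandEnd i) u h1.ne_end.symm (by rwa [h.gs])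
    rw [h.fp] at c1
    rw [h.gs, h5] at c2
    have h6 := hval h3
    have h7 := hval h4
    have h8 := hval huq
    unfold ArcsCross at c1 c2
    unfold IsLeft at h1 h2 hq
    simp only [Fin.lt_def] at *
    omega
  have hkf : (crossed f i).length ≤ 1 := by
    by_contra hlen
    obtain ⟨u, h1, h2, h3, h4⟩ := hS2 (by omega)
    refine hnone u h1 h2 h3 h4 (h.eq u h1.ne_start ?_ (isLeft_ne h1 hr) h1.ne_end)
    rintro rfl
    exact h3 h.fq
  have hkg : (crossed g i).length ≤ 1 := by
    by_contra hlen
    obtain ⟨u, h1, h2, h3, h4⟩ := hT2 (by omega)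
    have e : T u = S u := by
      refine h.eq u h1.ne_start ?_ (isLeft_ne h1 hr) h1.ne_end
      rintro rfl
      exact h4 h.gq
    rw [e] at h2 h3 h4
    exact hnone u h1 h2 h3 h4 e
  -- Undoing the single surgery of either system gives back the strand and the arc `q – r`.
  refine ⟨addStrand_inj hf hg hi ?_, hkf, hkg⟩
  obtain ⟨x, hx⟩ := List.length_eq_one_iff.1
    (le_antisymm hkf (List.length_pos_iff.2 hcf))
  obtain ⟨y, hy⟩ := List.length_eq_one_iff.1
    (le_antisymm hkg (List.length_pos_iff.2 hcg))
  rw [hx] at hSx hSdef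
  rw [hy] at hTx hTdef
  simp only [List.map, List.mem_singleton, exists_eq_left, h.fp, h.gp] at hSx hTx
  simp only [List.map, ← hSx, chain] at hSdef
  simp only [List.map, ← hTx, chain] at hTdef
  rw [← surger_surger (strandEnd i) q (addStrand f i), ← hSdef,
    ← surger_surger (strandEnd i) r (addStrand g i), ← hTdef]
  have hab := strandStart_ne_strandEnd i i
  funext u
  by_cases h1 : u = strandStart i
  · rw [h1, surger_apply_of_apply_eq_right hab h.pq h.fp,
      surger_apply_of_apply_eq_right hab h.pr h.gp]
  by_cases h2 : u = strandEnd i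
  · rw [h2, surger_apply_left, surger_apply_left, h.fq, h.gr] <;> simp only [h.fq, h.gr]
    exacts [hab, h.pr, hab, h.pq]
  by_cases h3 : u = q
  · rw [h3, surger_apply_right, surger_apply_of_apply_eq_left hq.ne_end h.qr h.gq, h.fs] <;>
      rw [h.fs]
    exacts [hrb, h.qr.symm]
  by_cases h4 : u = r
  · rw [h4, surger_apply_of_apply_eq_left hrb h.qr.symm h.fr, surger_apply_right, h.gs] <;>
      rw [h.gs]
    exacts [hq.ne_end, h.qr]
  have e := h.eq u h1 h3 h4 h2
  have hSu : S u ≠ strandEnd i := fun h' => h4 (by rw [← hS.involutive u, h', h.fs])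
  have hSq : S u ≠ q := fun h' => h1 (by rw [← hS.involutive u, h', h.fq])
  have hSr : S u ≠ r := fun h' => h2 (by rw [← hS.involutive u, h', h.fr])
  rw [surger_apply_of_ne h2 h3 hSu hSq, surger_apply_of_ne h2 h4 (by rwa [e]) (by rwa [e]), e]

end MultiSkein

/-! ### Induction on the strands: highest and lowest resolutions are far apart. -/

namespace MultiSkein

variable {n : ℕ} {l : List (Fin n)} {f g : Fin (2 * n) → Fin (2 * n)} {i : Fin n} {t u : ℤ}

/-- The strand to which an endpoint belongs. -/
def strandOf (p : Fin (2 * n)) : Fin n := ⟨p % n, Nat.mod_lt _ (by have := p.2; omega)⟩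

theorem strandOf_start (i : Fin n) : strandOf (strandStart i) = i := by
  simp [strandOf, strandStart, Nat.mod_eq_of_lt i.2]

theorem strandOf_end (i : Fin n) : strandOf (strandEnd i) = i := by
  simp [strandOf, strandEnd, Nat.mod_eq_of_lt i.2]

theorem eq_or_eq_of_strandOf_eq {p q : Fin (2 * n)} (h : strandOf p = strandOf q) :
    p = q ∨ (p : ℕ) + n = q ∨ (q : ℕ) + n = p := by
  have hp := p.2
  have hq := q.2
  have h' : (p : ℕ) % n = q % n := congrArg Fin.val h
  have hmod : ∀ x < 2 * n, x % n = x ∨ x % n + n = x := by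
    intro x hx
    rcases lt_or_ge x n with h | h
    · exact Or.inl (Nat.mod_eq_of_lt h)
    · right
      rw [Nat.mod_eq_sub_mod h, Nat.mod_eq_of_lt (by omega)]
      omega
  rw [Fin.ext_iff]
  have := hmod p hp
  have := hmod q hq
  omega

/-- Two points on the same side of a strand belong to different strands. -/
theorem strandOf_ne {p q : Fin (2 * n)} (hpq : p ≠ q) (hside : IsLeft i p ↔ IsLeft i q)
    (hp : p ≠ strandStart i ∧ p ≠ strandEnd i) (hq : q ≠ strandStart i ∧ q ≠ strandEnd i) :
    strandOf p ≠ strandOf q := by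
  intro h
  have h1 := eq_or_eq_of_strandOf_eq h
  have := p.2
  have := q.2
  have := i.2
  simp only [IsLeft, strandStart, strandEnd, Fin.lt_def, Fin.ext_iff, Ne] at *
  omega

theorem IsSystem.strandOf_mem (hf : IsSystem l f) {p : Fin (2 * n)} (hp : f p ≠ p) :
    strandOf p ∈ l := by
  obtain ⟨j, hj, rfl | rfl⟩ := (hf.ne_self_iff p).1 hp
  · rwa [strandOf_start]
  · rwa [strandOf_end]

theorem MovePoints.of_addStrand (hf : IsSystem l f) (hg : IsSystem l g) (hi : i ∉ l)
    {p q r s : Fin (2 * n)} (h : MovePoints (addStrand f i) (addStrand g i) p q r s) :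
    MovePoints f g p q r s ∧
      ∀ v, v = p ∨ v = q ∨ v = r ∨ v = s → v ≠ strandStart i ∧ v ≠ strandEnd i := by
  have key : ∀ {p q r s}, MovePoints (addStrand f i) (addStrand g i) p q r s →
      p ≠ strandStart i ∧ p ≠ strandEnd i := by
    intro p q r s h
    have hne : addStrand f i p ≠ addStrand g i p := by
      rw [h.fp, h.gp]; exact h.qr
    refine ⟨?_, ?_⟩ <;> rintro rfl
    · exact hne (by rw [addStrand_start, addStrand_start])
    · exact hne (by rw [addStrand_end, addStrand_end])
  obtain ⟨p1, p2⟩ := key h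
  obtain ⟨q1, q2⟩ := key h.symm_left
  obtain ⟨r1, r2⟩ := key h.symm_right
  obtain ⟨s1, s2⟩ := key h.symm_right.symm_left
  have e : ∀ k : Fin (2 * n) → Fin (2 * n), addStrand k i p = k p ∧ addStrand k i q = k q ∧
      addStrand k i r = k r ∧ addStrand k i s = k s := fun k =>
    ⟨addStrand_of_ne p1 p2, addStrand_of_ne q1 q2, addStrand_of_ne r1 r2, addStrand_of_ne s1 s2⟩
  obtain ⟨f1, f2, f3, f4⟩ := e f
  obtain ⟨g1, g2, g3, g4⟩ := e g
  refine ⟨⟨f1 ▸ h.fp, f2 ▸ h.fq, f3 ▸ h.fr, f4 ▸ h.fs, g1 ▸ h.gp, g3 ▸ h.gr, g2 ▸ h.gq, g4 ▸ h.gs,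
    h.pq, h.pr, h.ps, h.qr, h.qs, h.rs, fun v h1 h2 h3 h4 => ?_⟩, ?_⟩
  · by_cases h5 : v = strandStart i
    · rw [h5, hf.start_eq hi, hg.start_eq hi]
    by_cases h6 : v = strandEnd i
    · rw [h6, hf.end_eq hi, hg.end_eq hi]
    have := h.eq v h1 h2 h3 h4
    rwa [addStrand_of_ne h5 h6, addStrand_of_ne h5 h6] at this
  · rintro v (rfl | rfl | rfl | rfl)
    exacts [⟨p1, p2⟩, ⟨q1, q2⟩, ⟨r1, r2⟩, ⟨s1, s2⟩]

/-- Two systems of arcs that are not crossed by strand `i` and differ by a move have at least three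
strands, as all four ends of the arcs moved lie on one side of `i`. -/
theorem three_le_length_of_arcMove (hf : IsSystem l f) (hg : IsSystem l g) (hi : i ∉ l)
    (hcf : crossed f i = []) (hcg : crossed g i = [])
    (h : ArcMove (addStrand f i) (addStrand g i)) : 3 ≤ l.length ∧ ArcMove f g := by
  obtain ⟨p, q, r, s, h⟩ := MovePoints.of_involutive (hf.addStrand_involutive hi)
    (hg.addStrand_involutive hi) (fun v hv => by
      by_contra hne
      exact (hf.addStrand_ne_self_iff v).2 ((hg.addStrand_ne_self_iff v).1 hne) hv) h
  obtain ⟨h, hne⟩ := h.of_addStrand hf hg hi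
  refine ⟨?_, h.arcMove⟩
  have hside : ∀ {k : Fin (2 * n) → Fin (2 * n)} {x y : Fin (2 * n)}, crossed k i = [] →
      k x = y → k y = x → (IsLeft i x ↔ IsLeft i y) := by
    intro k x y hk h1 h2
    have h3 : x ∉ crossed k i := by simp [hk]
    have h4 : y ∉ crossed k i := by simp [hk]
    rw [mem_crossed, h1] at h3
    rw [mem_crossed, h2] at h4
    tauto
  have hpq := hside hcf h.fp h.fq
  have hpr := hside hcg h.gp h.gr
  have e1 := strandOf_ne h.pq hpq (hne p (by simp)) (hne q (by simp))
  have e2 := strandOf_ne h.pr hpr (hne p (by simp)) (hne r (by simp))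
  have e3 := strandOf_ne h.qr (hpq.symm.trans hpr) (hne q (by simp)) (hne r (by simp))
  have hnd : [strandOf p, strandOf q, strandOf r].Nodup := by simp [e1, e2, e3]
  refine (hnd.subperm ?_).length_le
  have m1 := hf.strandOf_mem (p := p) (by rw [h.fp]; exact h.pq.symm)
  have m2 := hf.strandOf_mem (p := q) (by rw [h.fq]; exact h.pq)
  have m3 := hf.strandOf_mem (p := r) (by rw [h.fr]; exact h.rs.symm)
  intro x hx
  simp only [List.mem_cons, List.not_mem_nil, or_false] at hx
  rcases hx with rfl | rfl | rfl <;> assumption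

/-- Two strands always cross, since their ends interlace. This starts the induction. -/
theorem crossed_ne_nil_of_singleton {j : Fin n} (hij : i ≠ j) (hf : IsSystem [j] f) :
    crossed f i ≠ [] := by
  have hS : f (strandStart j) = strandEnd j := by
    have h1 : f (strandStart j) ≠ strandStart j := (hf.ne_self_iff _).2 ⟨j, by simp, Or.inl rfl⟩
    have h2 : f (f (strandStart j)) ≠ f (strandStart j) := fun h => h1 (hf.involutive.injective h)
    obtain ⟨k, hk, h3⟩ := (hf.ne_self_iff _).1 h2
    rw [List.mem_singleton.1 hk] at h3
    exact h3.resolve_left h1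
  have hE : f (strandEnd j) = strandStart j := by rw [← hS, hf.involutive]
  intro hnil
  have h1 : strandStart j ∉ crossed f i := by simp [hnil]
  have h2 : strandEnd j ∉ crossed f i := by simp [hnil]
  rw [mem_crossed, hS] at h1
  rw [mem_crossed, hE] at h2
  have := i.2
  have := j.2
  simp only [IsLeft, strandStart, strandEnd, Fin.lt_def, Fin.ext_iff, Ne] at *
  omega

/-- A highest and a lowest resolution are different, and they do not differ by a single move if
there are at least three strands. -/
theorem IsExtreme.ne_and_not_arcMove (hl : l.Nodup) (hlen : 2 ≤ l.length)
    (hf : IsExtreme true (lay l) f t) (hg : IsExtreme false (lay l) g u) :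
    f ≠ g ∧ (3 ≤ l.length → ¬ ArcMove f g) := by
  induction l using List.reverseRecOn generalizing f g t u with
  | nil => simp at hlen
  | append_singleton l i ih =>
    have hS := isSystem_of_mem_lay hl hf.1
    have hT := isSystem_of_mem_lay hl hg.1
    rw [List.nodup_append] at hl
    have hi : i ∉ l := fun hi => hl.2.2 i hi i (by simp) rfl
    replace hl := hl.1
    obtain ⟨f', t', hf', rfl, rfl⟩ := hf.exists_eq_uniformResolution hl hi
    obtain ⟨g', u', hg', rfl, rfl⟩ := hg.exists_eq_uniformResolution hl hi
    have hsf := isSystem_of_mem_lay hl hf'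
    have hsg := isSystem_of_mem_lay hl hg'
    rw [List.length_append, List.length_singleton] at hlen ⊢
    -- Distinctness from two strands on and the absence of a move from three on are proved together,
    -- because the last case derives the second from the first. The two resolutions of a double
    -- crossing do differ by a move.
    by_cases hcf : crossed f' i = [] <;> by_cases hcg : crossed g' i = []
    · have hl2 : 2 ≤ l.length := by
        by_contra hlt
        obtain ⟨j, rfl⟩ := List.length_eq_one_iff.1 (show l.length = 1 by omega)
        exact crossed_ne_nil_of_singleton (fun h => hi (by simp [h])) hsf hcf
      obtain ⟨h1, h2⟩ := ih hl hl2 (hf.of_uniformResolution hl hi hf' (by simp [hcf]))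
        (hg.of_uniformResolution hl hi hg' (by simp [hcg]))
      rw [uniformResolution, uniformResolution, hcf, hcg]
      refine ⟨fun h => h1 (addStrand_inj hsf hsg hi h), fun _ h => ?_⟩
      obtain ⟨h3, h4⟩ := three_le_length_of_arcMove hsf hsg hi hcf hcg h
      exact h2 h3 h4
    -- Only one of the two strands meets arcs below: the other joins its own ends, whereas this one
    -- sends its ends to different sides.
    · have hTa := uniformResolution_start hsg hi false hcg
      have hTb := uniformResolution_end hsg hi false hcg
      have e : uniformResolution true f' i = addStrand f' i := by
        rw [uniformResolution, hcf]; rfl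
      constructor
      · intro h
        exact hTa.2 (by rw [← h, e, addStrand_start])
      · intro _
        rw [e]
        exact not_arcMove_addStrand hi hsf hcf hT (by simp [hTa.1, hTb.1]) hTa.2
    · have hSa := uniformResolution_start hsf hi true hcf
      have hSb := uniformResolution_end hsf hi true hcf
      have e : uniformResolution false g' i = addStrand g' i := by
        rw [uniformResolution, hcg]; rfl
      constructor
      · intro h
        exact hSa.2 (by rw [h, e, addStrand_start])
      · intro _ h
        refine not_arcMove_addStrand hi hsg hcg hS (by simp [hSa.1, hSb.1]) hSa.2 ?_
        rw [← e]
        exact h.symm (hS.apply_eq_self_imp hT)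
    · constructor
      · intro h
        have hSa := (uniformResolution_start hsf hi true hcf).1
        have hTa := (uniformResolution_start hsg hi false hcg).1
        rw [h] at hSa
        simp [hTa] at hSa
      · intro hl3 h
        -- A move would force the same arcs below, met once. They would be a highest and a lowest
        -- resolution of at least two strands, which are distinct.
        obtain ⟨rfl, h1, h2⟩ := eq_of_arcMove_uniformResolution hsf hsg hi hcf hcg hS hT h
        exact (ih hl (by omega) (hf.of_uniformResolution hl hi hf' h1)
          (hg.of_uniformResolution hl hi hg' h2)).1 rfl

/-! ### High and low splits as extreme resolutions, and the conclusion. -/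

theorem nodup_map_finRange (σ : Equiv.Perm (Fin n)) : ((List.finRange n).map σ).Nodup :=
  (List.nodup_finRange n).map σ.injective

variable {σ : Equiv.Perm (Fin n)}

/-- The split formed by a resolution of all strands. -/
def splitOfMem (h : (f, t) ∈ resolutions σ) : MultiSplit n :=
  have hsys := isSystem_of_mem_lay (nodup_map_finRange σ) (resolutions_eq_lay σ ▸ h)
  { partner := f
    involutive := hsys.involutive
    ne_self := fun p => (hsys.ne_self_iff p).2 (by
      have hp := p.2
      rcases lt_or_ge (p : ℕ) n with hlt | hge
      · exact ⟨⟨p, hlt⟩, by simpa using σ.surjective _, Or.inl rfl⟩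
      · refine ⟨⟨p - n, by omega⟩, by simpa using σ.surjective _, Or.inr ?_⟩
        simp only [strandEnd, Fin.ext_iff]
        omega)
    noncrossing := fun p q h1 h2 => by
      have hne : f q ≠ p := fun h => by
        rw [← h, hsys.involutive] at h2
        exact lt_irrefl _ h2
      have hne' : f q ≠ f p := fun h => h1.ne (hsys.involutive.injective h).symm
      have := hsys.noncrossing p q h1.ne h2.ne'
      unfold ArcsCross at this
      simp only [Fin.lt_def, Fin.ext_iff, Ne] at *
      omega }

theorem isExtreme_of_isHighSplit {S : MultiSplit n} (h : IsHighSplit σ S) :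
    ∃ t, IsExtreme true (lay ((List.finRange n).map σ)) S.partner t := by
  obtain ⟨T, rfl, hT⟩ := h
  rw [← resolutions_eq_lay]
  -- A better resolution would be a term covering `T`.
  refine ⟨T.power, T.mem, fun g hg hmove => hT ⟨splitOfMem hg, _, hg⟩ (.single ⟨hmove, ?_⟩)⟩
  simp [splitSign]

theorem isExtreme_of_isLowSplit {S : MultiSplit n} (h : IsLowSplit σ S) :
    ∃ t, IsExtreme false (lay ((List.finRange n).map σ)) S.partner t := by
  obtain ⟨T, rfl, hT⟩ := h
  rw [← resolutions_eq_lay]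
  refine ⟨T.power, T.mem, fun g hg hmove => hT ⟨splitOfMem hg, _, hg⟩ (.single ⟨?_, ?_⟩)⟩
  -- The covering relation needs the move towards `T`; it can be reversed because splits have no
  -- fixed points.
  · exact hmove.symm fun x hx => absurd hx (T.split.ne_self x)
  · simp [splitSign]
    ring

end MultiSkein

theorem theorem3p1 (n c : ℕ) (hn : 3 ≤ n) (P : MultiProjection n c) (hP : P.IsConnected)
    (smax smin : P.State) (hmax : smax.IsMaximal) (hmin : smin.IsMinimal) :
    smax.components + smin.components ≤ (2 * n - 4) * c + 2 := by
  refine MultiProjection.components_add_components_le hn hP smax smin fun x => ?_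
  obtain ⟨t, ht⟩ := MultiSkein.isExtreme_of_isHighSplit (hmax.2 x)
  obtain ⟨u, hu⟩ := MultiSkein.isExtreme_of_isLowSplit (hmin.2 x)
  have hlen : ((List.finRange n).map (P.order x)).length = n := by simp
  obtain ⟨h1, h2⟩ := ht.ne_and_not_arcMove (MultiSkein.nodup_map_finRange _) (by omega) hu
  exact ⟨h1, h2 (by omega)⟩
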